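/- Let $\Omega\subset\mathbb R^3$ be a bounded domain with $\partial\Omega\in C^2$, $\nu$ the outward unit normal on $\partial\Omega$, and $k\ge 0$. Let $D$ be a nonempty open set with $\overline D\subset\Omega$ and let $\rho\in L^2(D)$ be complex-valued. Put $F_{\rho,D}=\rho$ in $D$ and $F_{\rho,D}=0$ in $\Omega\setminus D$, and let $u\in H^1(\Omega)$ (complex-valued) be any weak solution of $\Delta u+k^2u=F_{\rho,D}$ in $\Omega$. For unit vectors $\omega,\vartheta$ with $\omega\cdot\vartheta=0$ and $\tau>0$ let $v=e^{x\cdot(\tau\omega+i\sqrt{\tau^2+k^2}\,\vartheta)}$, $v_\tau=\partial_\tau v=\{x\cdot(\omega+i\frac{\tau}{\sqrt{\tau^2+k^2}}\vartheta)\}v$, and $$I_{\omega,\vartheta}(\tau)=\int_{\partial\Omega}\Big(\frac{\partial u}{\partial\nu}v-\frac{\partial v}{\partial\nu}u\Big)dS,\qquad I'_{\omega,\vartheta}(\tau)=\int_{\partial\Omega}\Big(\frac{\partial u}{\partial\nu}v_\tau-\frac{\partial v_\tau}{\partial\nu}u\Big)dS .$$ Here $u$ on $\partial\Omega$ is the trace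 of $u$ in $L^2(\partial\Omega)$, and $\int_{\partial\Omega}\frac{\partial u}{\partial\nu}w\,dS$ is understood in the weak sense, i.e. as $\int_\Omega(\nabla u\cdot\nabla w+(\Delta u)w)\,dx$, where $\Delta u\in L^2(\Omega)$ is the weak Laplacian of $u$. Let $h_D(\omega)=\sup_{x\in D}x\cdot\omega$. Assume the following. 1. $\omega$ is regular with respect to $D$: the set $\{x\in\overline D : x\cdot\omega=h_D(\omega)\}$ consists of a single point $p(\omega)$. 2. $D$ has a conical singularity from direction $\omega$: there are $\delta>0$ and a nonempty bounded relatively open subset $Q$ of the plane $x\cdot\omega=h_D(\omega)-\delta$ such that, with $p=p(\omega)$, $$D\cap\{x : h_D(\omega)-\delta<x\cdot\omega<h_D(\omega)\}=D_{(p,\omega)}(\delta,Q):=\bigcup_{0<s<\delta}\Big\{p+\frac s\delta(z-p) : z\in Q\Big\}.$$ 3. $F_{\rho,D}$ is active at $p=p(\omega)$: there are $\eta>0$, $0<\alpha\le1$ and $\tilde\rho\in C^{0,\alpha}(\overline{B_\eta(p)})$ (complex-valued) with $\rho=\tilde\rho$ almost everywhere in $B_\eta(p)\cap D$ and $\tilde\rho(p)\ne0$.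 4. $C_{(p(\omega),\omega)}(\delta,Q,\vartheta)\neq0$, where $$C_{(p,\omega)}(\delta,Q,\vartheta)=2s\int_{Q_s}\frac{dS_z}{\{s-i(z-p)\cdot\vartheta\}^3},\qquad Q_s=D_{(p,\omega)}(\delta,Q)\cap\{x : x\cdot\omega=p\cdot\omega-s\},\quad 0<s<\delta ,$$ a quantity that does not depend on the choice of $s\in(0,\delta)$. Then there is $\tau_0>0$ such that $|I_{\omega,\vartheta}(\tau)|>0$ for all $\tau\ge\tau_0$, and $$\lim_{\tau\to\infty}\frac{\log|I_{\omega,\vartheta}(\tau)|}{\tau}=h_D(\omega),\qquad \lim_{\tau\to\infty}\frac{I'_{\omega,\vartheta}(\tau)}{I_{\omega,\vartheta}(\tau)}=h_D(\omega)+i\,p(\omega)\cdot\vartheta,$$ $$\lim_{\tau\to\infty}e^{-\tau t}|I_{\omega,\vartheta}(\tau)|=\begin{cases}0,& t\ge h_D(\omega),\\ \infty,& t<h_D(\omega).\end{cases}$$ -/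

import Mathlib

open MeasureTheory Filter Topology Metric
open scoped NNReal RealInnerProductSpace

noncomputable section

namespace EnclosureMethod

/-- Euclidean three-space. -/
abbrev E3 := EuclideanSpace ℝ (Fin 3)

/-- The partial derivative `∂f/∂xᵢ` of a complex-valued function on three-space. -/
def partialDeriv (i : Fin 3) (f : E3 → ℂ) (x : E3) : ℂ :=
  fderiv ℝ f x (EuclideanSpace.single i (1 : ℝ))

/-! ### Domains with `C²` boundary, surface measure, outward normal -/

/-- The boundary of `Ω` is of class `C²`: near each boundary point, after an isometric change of
the coordinates, `Ω` is the region lying above the graph of a `C²` function. -/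
def HasC2Boundary (Ω : Set E3) : Prop :=
  ∀ p ∈ frontier Ω, ∃ r > (0 : ℝ), ∃ (e : E3 ≃ₗᵢ[ℝ] E3) (γ : EuclideanSpace ℝ (Fin 2) → ℝ),
    ContDiff ℝ 2 γ ∧
      Ω ∩ ball p r = {x | x ∈ ball p r ∧ γ (!₂[e x 0, e x 1]) < e x 2}

/-- A bounded domain (nonempty connected open set) of three-space with `C²` boundary. -/
structure IsBoundedC2Domain (Ω : Set E3) : Prop where
  isOpen : IsOpen Ω
  isConnected : IsConnected Ω
  isBounded : Bornology.IsBounded Ω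
  c2 : HasC2Boundary Ω

/-- The surface measure `dS` on a set `S` of dimension two: the two-dimensional Hausdorff measure,
normalised so that it is the usual area on planes. -/
def surfaceMeasure (S : Set E3) : Measure E3 := (μHE[2] : Measure E3).restrict S

/-- `n` is the outward unit normal to `Ω` at `x`: directions making an obtuse angle with `n` enter
`Ω`, directions making an acute angle with `n` leave the closure of `Ω`. -/
structure IsOutwardUnitNormal (Ω : Set E3) (x n : E3) : Prop where
  norm_eq : ‖n‖ = 1
  enters : ∀ d : E3, ⟪d, n⟫ < 0 → ∀ᶠ t : ℝ in 𝓝[>] 0, x + t • d ∈ Ω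
  leaves : ∀ d : E3, 0 < ⟪d, n⟫ → ∀ᶠ t : ℝ in 𝓝[>] 0, x + t • d ∉ closure Ω

open Classical in
/-- The field `ν` of outward unit normals (`0` where there is none; there is at most one, and
there is one at every point of a `C²` boundary). -/
def outwardNormal (Ω : Set E3) (x : E3) : E3 :=
  if h : ∃ n, IsOutwardUnitNormal Ω x n then h.choose else 0

/-- The normal derivative `∂w/∂ν` at `x` of a function `w` that is differentiable at `x`. -/
def normalDeriv (Ω : Set E3) (w : E3 → ℂ) (x : E3) : ℂ := fderiv ℝ w x (outwardNormal Ω x)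

/-! ### The Sobolev space `H¹`, traces, weak solutions -/

/-- Complex-valued smooth functions with compact support in `Ω`. -/
structure IsTestFunction (Ω : Set E3) (φ : E3 → ℂ) : Prop where
  smooth : ContDiff ℝ (⊤ : ℕ∞) φ
  compact : HasCompactSupport φ
  support : tsupport φ ⊆ Ω

/-- Elements of `H¹(Ω)`: a square integrable function together with its square integrable weak
partial derivatives. -/
structure SobolevH1 (Ω : Set E3) where
  /-- the function -/
  toFun : E3 → ℂ
  /-- its weak partial derivatives -/
  grad : Fin 3 → E3 → ℂ
  memLp : MemLp toFun 2 (volume.restrict Ω)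
  memLp_grad : ∀ i, MemLp (grad i) 2 (volume.restrict Ω)
  weak : ∀ (i : Fin 3) (φ : E3 → ℂ), IsTestFunction Ω φ →
    ∫ x in Ω, toFun x * partialDeriv i φ x = -∫ x in Ω, grad i x * φ x

variable {Ω : Set E3}

/-- `g` is the trace on `∂Ω` of `u ∈ H¹(Ω)`: it is the limit in `L²(∂Ω)` of the restrictions to
`∂Ω` of functions that are smooth up to the boundary and converge to `u` in `H¹(Ω)`. -/
structure IsTrace (u : SobolevH1 Ω) (g : E3 → ℂ) : Prop where
  memLp : MemLp g 2 (surfaceMeasure (frontier Ω))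
  approx : ∃ φ : ℕ → E3 → ℂ, (∀ n, ContDiff ℝ (⊤ : ℕ∞) (φ n)) ∧
    Tendsto (fun n => eLpNorm (fun x => φ n x - u.toFun x) 2 (volume.restrict Ω)) atTop (𝓝 0) ∧
    (∀ i, Tendsto (fun n => eLpNorm (fun x => partialDeriv i (φ n) x - u.grad i x) 2
      (volume.restrict Ω)) atTop (𝓝 0)) ∧
    Tendsto (fun n => eLpNorm (fun x => φ n x - g x) 2 (surfaceMeasure (frontier Ω)))
      atTop (𝓝 0)

/-- `u ∈ H¹(Ω)` is a weak solution of `Δu + k²u = F` in `Ω`. -/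
def IsWeakSolution (k : ℝ) (F : E3 → ℂ) (u : SobolevH1 Ω) : Prop :=
  ∀ φ : E3 → ℂ, IsTestFunction Ω φ →
    ∫ x in Ω, (-(∑ i, u.grad i x * partialDeriv i φ x) + (k : ℂ) ^ 2 * u.toFun x * φ x)
      = ∫ x in Ω, F x * φ x

/-- `f ∈ L²(Ω)` is the weak Laplacian of `u ∈ H¹(Ω)`. -/
structure HasWeakLaplacian (u : SobolevH1 Ω) (f : E3 → ℂ) : Prop where
  memLp : MemLp f 2 (volume.restrict Ω)
  weak : ∀ φ : E3 → ℂ, IsTestFunction Ω φ →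
    -∫ x in Ω, ∑ i, u.grad i x * partialDeriv i φ x = ∫ x in Ω, f x * φ x

open Classical in
/-- The weak Laplacian of `u ∈ H¹(Ω)` if it is square integrable (it is then unique almost
everywhere in `Ω`), and `0` otherwise. -/
def weakLaplacian (u : SobolevH1 Ω) : E3 → ℂ :=
  if h : ∃ f, HasWeakLaplacian u f then h.choose else 0

/-- The weak normal derivative of `u ∈ H¹(Ω)` with `Δu ∈ L²(Ω)`, an element of the dual
`H^{-1/2}(∂Ω)` of `H^{1/2}(∂Ω)`, paired with the boundary values of a function `w` smooth up to
the boundary: the standard interpretation of `∫_{∂Ω} (∂u/∂ν) w dS`, namely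
`∫_Ω (∇u · ∇w + (Δu) w) dx`. -/
def normalDerivPairing (u : SobolevH1 Ω) (w : E3 → ℂ) : ℂ :=
  ∫ x in Ω, ((∑ i, u.grad i x * partialDeriv i w x) + weakLaplacian u x * w x)

/-! ### The source, its support function, conical singularities -/

open Classical in
/-- The source `F_{ρ,D}`: equal to `ρ` in `D` and to `0` outside `D`. -/
def source (ρ : E3 → ℂ) (D : Set E3) (x : E3) : ℂ := if x ∈ D then ρ x else 0

/-- The support function `h_D(ω) = sup_{x ∈ D} x · ω`. -/
def supportFn (D : Set E3) (ω : E3) : ℝ := sSup ((fun x => ⟪x, ω⟫) '' D)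

/-- The set of the points `x` of the closure of `D` with `x · ω = h_D(ω)`. -/
def supportFace (D : Set E3) (ω : E3) : Set E3 := {x | x ∈ closure D ∧ ⟪x, ω⟫ = supportFn D ω}

/-- `ω` is regular with respect to `D`, and `p = p(ω)` is the only point of the closure of `D`
with `p · ω = h_D(ω)`. -/
def IsRegularAt (D : Set E3) (ω p : E3) : Prop := supportFace D ω = {p}

/-- The cone `D_{(p,ω)}(δ,Q)` with apex `p`, base `Q` and height `δ`. -/
def cone (p : E3) (δ : ℝ) (Q : Set E3) : Set E3 :=
  {x | ∃ s : ℝ, 0 < s ∧ s < δ ∧ ∃ z ∈ Q, x = p + (s / δ) • (z - p)}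

/-- `Q` is a nonempty bounded relatively open subset of the plane `x · ω = p · ω - δ`. -/
structure IsConeBase (p ω : E3) (δ : ℝ) (Q : Set E3) : Prop where
  nonempty : Q.Nonempty
  bounded : Bornology.IsBounded Q
  relOpen : ∃ U : Set E3, IsOpen U ∧ Q = U ∩ {x | ⟪x, ω⟫ = ⟪p, ω⟫ - δ}

/-- `D` has a conical singularity at `p = p(ω)` from the direction `ω`, realised by the height `δ`
and the base `Q`. -/
structure HasConicalSingularity (D : Set E3) (ω p : E3) (δ : ℝ) (Q : Set E3) : Prop where
  pos : 0 < δ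
  base : IsConeBase p ω δ Q
  eq_cone : D ∩ {x | supportFn D ω - δ < ⟪x, ω⟫ ∧ ⟪x, ω⟫ < supportFn D ω} = cone p δ Q

/-- The section `Q_s` of the cone by the plane `x · ω = p · ω - s`. -/
def coneSection (p ω : E3) (δ : ℝ) (Q : Set E3) (s : ℝ) : Set E3 :=
  cone p δ Q ∩ {x | ⟪x, ω⟫ = ⟪p, ω⟫ - s}

/-- The constant `C_{(p,ω)}(δ,Q,ϑ) = 2s ∫_{Q_s} dS_z / (s - i (z - p)·ϑ)³`, computed on the section
at the height `0 < s < δ` (the value does not depend on `s`). -/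
def coneConstant (p ω : E3) (δ : ℝ) (Q : Set E3) (ϑ : E3) (s : ℝ) : ℂ :=
  2 * (s : ℂ) * ∫ z, 1 / ((s : ℂ) - Complex.I * (⟪z - p, ϑ⟫ : ℝ)) ^ 3
    ∂(surfaceMeasure (coneSection p ω δ Q s))

/-- The source `F_{ρ,D}` is active at `p`: near `p` the strength `ρ` agrees almost everywhere in
`D` with a Hölder continuous function that does not vanish at `p`. -/
def IsActive (ρ : E3 → ℂ) (D : Set E3) (p : E3) : Prop :=
  ∃ η > (0 : ℝ), ∃ α : ℝ≥0, 0 < α ∧ α ≤ 1 ∧ ∃ ρ' : E3 → ℂ,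
    (∃ C : ℝ≥0, HolderOnWith C α ρ' (closedBall p η)) ∧
    (∀ᵐ x ∂(volume.restrict (ball p η ∩ D)), ρ x = ρ' x) ∧ ρ' p ≠ 0

/-! ### The indicator function -/

/-- The exponential solution `v = exp (x · (τ ω + i √(τ² + k²) ϑ))` of the Helmholtz equation. -/
def expSol (k : ℝ) (ω ϑ : E3) (τ : ℝ) (x : E3) : ℂ :=
  Complex.exp ((τ : ℂ) * (⟪x, ω⟫ : ℝ) + Complex.I * (Real.sqrt (τ ^ 2 + k ^ 2) : ℝ) * (⟪x, ϑ⟫ : ℝ))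

/-- The derivative `∂v/∂τ = (x · (ω + i τ / √(τ² + k²) ϑ)) v`. -/
def expSolDeriv (k : ℝ) (ω ϑ : E3) (τ : ℝ) (x : E3) : ℂ :=
  ((⟪x, ω⟫ : ℝ) + Complex.I * (τ / Real.sqrt (τ ^ 2 + k ^ 2) : ℝ) * (⟪x, ϑ⟫ : ℝ))
    * expSol k ω ϑ τ x

/-- The boundary integral `∫_{∂Ω} ((∂u/∂ν) w - (∂w/∂ν) u) dS` for `u ∈ H¹(Ω)` with trace `g`. -/
def boundaryForm (u : SobolevH1 Ω) (g w : E3 → ℂ) : ℂ :=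
  normalDerivPairing u w - ∫ x, normalDeriv Ω w x * g x ∂(surfaceMeasure (frontier Ω))

/-- The indicator function `I_{ω,ϑ}(τ)`. -/
def indicatorFn (k : ℝ) (u : SobolevH1 Ω) (g : E3 → ℂ) (ω ϑ : E3) (τ : ℝ) : ℂ :=
  boundaryForm u g (expSol k ω ϑ τ)

/-- The derivative `I'_{ω,ϑ}(τ)` of the indicator function, given by the same boundary integral
with `∂v/∂τ` in place of `v`. -/
def indicatorFnDeriv (k : ℝ) (u : SobolevH1 Ω) (g : E3 → ℂ) (ω ϑ : E3) (τ : ℝ) : ℂ :=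
  boundaryForm u g (expSolDeriv k ω ϑ τ)

end EnclosureMethod

end

open EnclosureMethod

/-! The plane-wave factor satisfies the Helmholtz equation because `(τω + i√(τ²+k²)ϑ)·(τω +
i√(τ²+k²)ϑ) = -k²`. Differentiating this identity in `τ` shows that `v_τ` satisfies it too. Green's
formula therefore collapses both boundary integrals to volume integrals over the source: `I(τ) = ∫_D
ρ v` and `I'(τ) = ∫_D ρ v_τ` (`boundaryForm_eq_integral`).

Since `|v| = exp(τ x·ω)`, these integrals are dominated by the part of `D` near the apex `p`; the
rest is smaller by a factor `exp(-τδ')`. Near `p` the set `D` is a cone, so the substitution `x = p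
+ y/τ` turns it into larger and larger truncations of a fixed infinite cone. Let `E(τ)` be the
exponent of `v` at `p`. By dominated convergence `τ³ exp(-E(τ)) I(τ) → ρ̃(p) ∫_cone exp(y·ω + i y·ϑ)
dy`. Slicing the cone by planes orthogonal to `ω` shows that the last integral is the constant `C`,
so the limit is not zero (`tendsto_integral_mul_expSol`, `integral_infCone_eq_coneConstant`). For
`v_τ` the extra factor converges to its value `h_D(ω) + i p·ϑ` at `p`. As `Re E(τ) = τ h_D(ω)`, all
the conclusions can be read off from the two limits.

The analytic groundwork is Green's formula for an `H¹` function with a trace, where area is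
Hausdorff measure. It rests on the area formula for `C¹` graphs (comparison with tangent planes),
the divergence theorem above a graph (a shear flattens the boundary), a partition of unity, and
density of smooth functions. -/

noncomputable section

namespace EnclosureMethod

/-! ### Area formula for graphs -/

/-- The Euclidean plane. -/
abbrev E2 := EuclideanSpace ℝ (Fin 2)

/-- The hypothesis forces `f` to factor through `g` on `A` by a `K`-Lipschitz map `F`, and a
Lipschitz map enlarges Hausdorff measure by at most `K ^ d`. This compares a graph with its tangent
plane. -/
theorem euclideanHausdorffMeasure_image_le_of_dist_le {α X Y : Type*} [MetricSpace X]
    [MeasurableSpace X] [BorelSpace X] [MetricSpace Y] [MeasurableSpace Y] [BorelSpace Y]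
    {f : α → X} {g : α → Y} {A : Set α} {K : ℝ≥0} (d : ℕ)
    (h : ∀ x ∈ A, ∀ y ∈ A, dist (f x) (f y) ≤ K * dist (g x) (g y)) :
    (μHE[d] : Measure X) (f '' A) ≤ (K : ENNReal) ^ d * (μHE[d] : Measure Y) (g '' A) := by
  classical
  rcases A.eq_empty_or_nonempty with rfl | ⟨a, ha⟩
  · simp
  have : Nonempty α := ⟨a⟩
  set F : Y → X := fun y => f (Function.invFunOn g A y) with hF
  have key : ∀ x ∈ A, F (g x) = f x := by
    intro x hx
    have h1 : ∃ a ∈ A, g a = g x := ⟨x, hx, rfl⟩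
    have h2 := Function.invFunOn_mem h1
    have h3 := Function.invFunOn_eq h1
    have h4 := h _ h2 x hx
    rw [h3, dist_self, mul_zero] at h4
    exact dist_le_zero.1 h4
  have himg : f '' A = F '' (g '' A) := by
    rw [Set.image_image]
    exact Set.image_congr fun x hx => (key x hx).symm
  have hlip : LipschitzOnWith K F (g '' A) := by
    refine LipschitzOnWith.of_dist_le_mul ?_
    rintro _ ⟨x, hx, rfl⟩ _ ⟨y, hy, rfl⟩
    rw [key x hx, key y hy]
    exact h x hx y hy
  rw [himg]
  have h1 := hlip.hausdorffMeasure_image_le (d := d) (by positivity)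
  simp only [Measure.euclideanHausdorffMeasure_def, Measure.smul_apply]
  rw [ENNReal.rpow_natCast] at h1
  rw [mul_smul_comm]
  simp only [ENNReal.smul_def, smul_eq_mul]
  gcongr

/-- By second countability, countably many of the neighbourhoods cover the space. Made disjoint,
they cut `A` into countably many pieces on which the inequality is known. -/
theorem measure_le_mul_of_locally {X : Type*} [TopologicalSpace X] [SecondCountableTopology X]
    [MeasurableSpace X] [OpensMeasurableSpace X] {μ ν : Measure X} {c : ENNReal}
    (h : ∀ x, ∃ U : Set X, IsOpen U ∧ x ∈ U ∧ ∀ A ⊆ U, MeasurableSet A → μ A ≤ c * ν A)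
    {A : Set X} (hA : MeasurableSet A) : μ A ≤ c * ν A := by
  choose U hUo hxU hU using h
  obtain ⟨s, hs, hcov⟩ := TopologicalSpace.countable_cover_nhds fun x => (hUo x).mem_nhds (hxU x)
  rcases s.eq_empty_or_nonempty with rfl | hne
  · have : A = ∅ := by
      simp only [Set.mem_empty_iff_false, Set.iUnion_of_empty, Set.iUnion_empty] at hcov
      exact Set.eq_empty_of_subset_empty (hcov ▸ Set.subset_univ A)
    simp [this]
  obtain ⟨x, rfl⟩ := hs.exists_eq_range hne
  set V : ℕ → Set X := disjointed fun n => U (x n) with hV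
  have hVm : ∀ n, MeasurableSet (V n) :=
    MeasurableSet.disjointed fun n => (hUo (x n)).measurableSet
  have hVU : ⋃ n, V n = Set.univ := by
    rw [hV, iUnion_disjointed]
    simpa using hcov
  have hdec : ∀ m : Measure X, m A = ∑' n, m (A ∩ V n) := by
    intro m
    rw [← measure_iUnion, ← Set.inter_iUnion, hVU, Set.inter_univ]
    · intro i j hij
      exact ((disjoint_disjointed fun n => U (x n)) hij).mono Set.inter_subset_right
        Set.inter_subset_right
    · exact fun n => hA.inter (hVm n)
  rw [hdec μ, hdec ν, ← ENNReal.tsum_mul_left]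
  refine ENNReal.tsum_le_tsum fun n => hU (x n) _ ?_ (hA.inter (hVm n))
  exact Set.inter_subset_right.trans (disjointed_subset _ n)

/-- The parametrisation `x ↦ (x, γ x)` of the graph of `γ`. -/
def graphMap (γ : E2 → ℝ) (x : E2) : E3 := !₂[x 0, x 1, γ x]

/-- The surface density `√(1 + |∇γ|²)` of the graph of `γ`. -/
def graphJacobian (γ : E2 → ℝ) (x : E2) : ℝ :=
  √(1 + fderiv ℝ γ x (EuclideanSpace.single 0 1) ^ 2
    + fderiv ℝ γ x (EuclideanSpace.single 1 1) ^ 2)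

theorem graphJacobian_pos (γ : E2 → ℝ) (x : E2) : 0 < graphJacobian γ x := by
  unfold graphJacobian; positivity

theorem continuous_graphJacobian {γ : E2 → ℝ} (hγ : ContDiff ℝ 1 γ) :
    Continuous (graphJacobian γ) := by
  have h := hγ.continuous_fderiv one_ne_zero
  unfold graphJacobian
  fun_prop

theorem continuous_graphMap {γ : E2 → ℝ} (hγ : Continuous γ) : Continuous (graphMap γ) := by
  unfold graphMap
  refine (PiLp.continuous_toLp 2 _).comp (continuous_pi fun i => ?_)
  fin_cases i <;> simp <;> fun_prop

theorem graphMap_injective (γ : E2 → ℝ) : Function.Injective (graphMap γ) := by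
  intro x y h
  ext i
  have h0 := congrArg (fun z : E3 => z 0) h
  have h1 := congrArg (fun z : E3 => z 1) h
  fin_cases i
  · simpa [graphMap] using h0
  · simpa [graphMap] using h1

theorem measurableEmbedding_graphMap {γ : E2 → ℝ} (hγ : Continuous γ) :
    MeasurableEmbedding (graphMap γ) :=
  (continuous_graphMap hγ).measurableEmbedding (graphMap_injective γ)

/-- The linear map `v ↦ (v, ℓ v)`. -/
def graphLinear (l : E2 →L[ℝ] ℝ) : E2 →ₗ[ℝ] E3 where
  toFun := graphMap l
  map_add' x y := by
    ext i; fin_cases i <;> simp [graphMap]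
  map_smul' c x := by
    ext i; fin_cases i <;> simp [graphMap]

/-- With `a`, `b` the values of `l` on the basis, the Gram determinant is `(1 + a²)(1 + b²) - (ab)²
= 1 + a² + b²`. -/
theorem normDet_graphLinear (l : E2 →L[ℝ] ℝ) :
    (graphLinear l).normDet = √(1 + l (EuclideanSpace.single 0 1) ^ 2
      + l (EuclideanSpace.single 1 1) ^ 2) := by
  rw [eq_comm, Real.sqrt_eq_iff_eq_sq (by positivity) (LinearMap.normDet_nonneg _)]
  have h := (graphLinear l).normDet_sq_eq_det_gram (EuclideanSpace.basisFun (Fin 2) ℝ)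
  rw [RCLike.ofReal_real_eq_id, id] at h
  rw [h, Matrix.det_fin_two]
  simp [Matrix.gram, graphLinear, graphMap, PiLp.inner_apply, Fin.sum_univ_three]
  ring

theorem dist_graphMap_sq (γ : E2 → ℝ) (x y : E2) :
    dist (graphMap γ x) (graphMap γ y) ^ 2 = dist x y ^ 2 + (γ x - γ y) ^ 2 := by
  rw [EuclideanSpace.dist_eq, EuclideanSpace.dist_eq, Real.sq_sqrt (by positivity),
    Real.sq_sqrt (by positivity)]
  simp [graphMap, Fin.sum_univ_three, Real.dist_eq]

theorem dist_le_dist_graphMap (γ : E2 → ℝ) (x y : E2) :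
    dist x y ≤ dist (graphMap γ x) (graphMap γ y) := by
  refine le_of_sq_le_sq ?_ dist_nonneg
  rw [dist_graphMap_sq]
  nlinarith [sq_nonneg (γ x - γ y)]

/-- The two chords differ only by a vertical vector, whose length is at most `ε * dist x y`, hence
at most `ε` times the second chord. -/
theorem dist_graphMap_le_of_abs_le {γ₁ γ₂ : E2 → ℝ} {x y : E2} {ε : ℝ} (hε : 0 ≤ ε)
    (h : |(γ₁ x - γ₁ y) - (γ₂ x - γ₂ y)| ≤ ε * dist x y) :
    dist (graphMap γ₁ x) (graphMap γ₁ y) ≤ (1 + ε) * dist (graphMap γ₂ x) (graphMap γ₂ y) := by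
  have h2 := dist_le_dist_graphMap γ₂ x y
  have e1 : graphMap γ₁ x - graphMap γ₁ y = (graphMap γ₂ x - graphMap γ₂ y)
      + EuclideanSpace.single 2 ((γ₁ x - γ₁ y) - (γ₂ x - γ₂ y)) := by
    ext i; fin_cases i <;> simp [graphMap]
  rw [dist_eq_norm, e1]
  calc _ ≤ ‖graphMap γ₂ x - graphMap γ₂ y‖
      + ‖(EuclideanSpace.single 2 ((γ₁ x - γ₁ y) - (γ₂ x - γ₂ y)) : E3)‖ := norm_add_le _ _
    _ ≤ dist (graphMap γ₂ x) (graphMap γ₂ y) + ε * dist (graphMap γ₂ x) (graphMap γ₂ y) := by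
      rw [dist_eq_norm, PiLp.norm_single, Real.norm_eq_abs, ← dist_eq_norm]
      gcongr
      exact h.trans (by gcongr)
    _ = _ := by ring

/-- Strict differentiability makes the linear approximation uniform in both endpoints, so that it
compares distances. The Jacobian bounds come from continuity and positivity. -/
theorem exists_ball_graphMap_approx {γ : E2 → ℝ} (hγ : ContDiff ℝ 1 γ) (x₀ : E2) {ε : ℝ}
    (hε : 0 < ε) : ∃ U : Set E2, IsOpen U ∧ x₀ ∈ U ∧
      (∀ x ∈ U, ∀ y ∈ U,
        |(γ x - γ y) - (fderiv ℝ γ x₀ x - fderiv ℝ γ x₀ y)| ≤ ε * dist x y) ∧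
      (∀ x ∈ U, graphJacobian γ x ≤ (1 + ε) * graphJacobian γ x₀) ∧
      (∀ x ∈ U, graphJacobian γ x₀ ≤ (1 + ε) * graphJacobian γ x) := by
  have hs : HasStrictFDerivAt γ (fderiv ℝ γ x₀) x₀ :=
    hγ.contDiffAt.hasStrictFDerivAt one_ne_zero
  obtain ⟨s', hs0', hs'⟩ := hs.approximates_deriv_on_nhds (c := ε.toNNReal) (Or.inr (by simpa))
  obtain ⟨s, hss, hs0⟩ := _root_.mem_nhds_iff.1 hs0'
  replace hs := hs'.mono_set hss
  have hJ := continuous_graphJacobian hγ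
  have hpos := graphJacobian_pos γ x₀
  refine ⟨s ∩ {x | graphJacobian γ x < (1 + ε) * graphJacobian γ x₀}
    ∩ {x | graphJacobian γ x₀ < (1 + ε) * graphJacobian γ x}, ?_, ?_, ?_, ?_, ?_⟩
  · exact (hs0.1.inter (isOpen_lt hJ continuous_const)).inter
      (isOpen_lt continuous_const (by fun_prop))
  · refine ⟨⟨hs0.2, ?_⟩, ?_⟩ <;> simp only [Set.mem_ofPred_eq] <;> nlinarith
  · intro x hx y hy
    have := hs x hx.1.1 y hy.1.1
    rwa [map_sub, Real.coe_toNNReal _ hε.le, ← dist_eq_norm] at this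
  · exact fun x hx => hx.1.2.le
  · exact fun x hx => hx.2.le

/-- Both sides are measures in `A`. Near each point the graph is compared with its tangent plane, at
the cost of `(1 + ε) ^ 2` for the area and `1 + ε` for the density. The local inequalities
globalise, and then `ε → 0`. -/
theorem euclideanHausdorffMeasure_graphMap_image {γ : E2 → ℝ} (hγ : ContDiff ℝ 1 γ) {A : Set E2}
    (hA : MeasurableSet A) :
    (μHE[2] : Measure E3) (graphMap γ '' A) = ∫⁻ x in A, ENNReal.ofReal (graphJacobian γ x) := by
  have hme := measurableEmbedding_graphMap hγ.continuous
  set ν₁ : Measure E2 := Measure.comap (graphMap γ) μHE[2] with hν₁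
  set ν₂ : Measure E2 := volume.withDensity fun x => ENNReal.ofReal (graphJacobian γ x) with hν₂
  have e1 : ∀ B, MeasurableSet B → ν₁ B = (μHE[2] : Measure E3) (graphMap γ '' B) :=
    fun B _ => hme.comap_apply _ _
  have e2 : ∀ B, MeasurableSet B → ν₂ B = ∫⁻ x in B, ENNReal.ofReal (graphJacobian γ x) :=
    fun B hB => withDensity_apply _ hB
  rw [← e1 A hA, ← e2 A hA]
  -- On a tangent plane the formula is exact: a linear map multiplies area by its `normDet`.
  have hlin : ∀ (x₀ : E2) (B : Set E2), (μHE[2] : Measure E3) (graphMap (fderiv ℝ γ x₀) '' B)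
      = ENNReal.ofReal (graphJacobian γ x₀) * volume B := by
    intro x₀ B
    have := (graphLinear (fderiv ℝ γ x₀)).euclideanHausdorffMeasure_image_eq_normDet_mul_volume B
    rwa [finrank_euclideanSpace_fin, normDet_graphLinear] at this
  have key : ∀ ε : ℝ, 0 < ε → ν₁ A ≤ ENNReal.ofReal ((1 + ε) ^ 3) * ν₂ A ∧
      ν₂ A ≤ ENNReal.ofReal ((1 + ε) ^ 3) * ν₁ A := by
    intro ε hε
    have hK : ((1 + ε).toNNReal : ENNReal) ^ 2 = ENNReal.ofReal ((1 + ε) ^ 2) := by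
      rw [ENNReal.ofReal_pow (by positivity)]; rfl
    have hK3 : ENNReal.ofReal ((1 + ε) ^ 3)
        = ENNReal.ofReal ((1 + ε) ^ 2) * ENNReal.ofReal (1 + ε) := by
      rw [← ENNReal.ofReal_mul (by positivity)]; congr 1
    constructor
    · refine measure_le_mul_of_locally (fun x₀ => ?_) hA
      obtain ⟨U, hUo, hxU, h1, h2, h3⟩ := exists_ball_graphMap_approx hγ x₀ hε
      refine ⟨U, hUo, hxU, fun B hB hBm => ?_⟩
      rw [e1 B hBm, e2 B hBm]
      have := euclideanHausdorffMeasure_image_le_of_dist_le (f := graphMap γ)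
        (g := graphMap (fderiv ℝ γ x₀)) (A := B) (K := (1 + ε).toNNReal) 2 (by
          intro x hx y hy
          rw [Real.coe_toNNReal _ (by positivity)]
          exact dist_graphMap_le_of_abs_le hε.le (h1 x (hB hx) y (hB hy)))
      refine this.trans ?_
      rw [hlin, hK, hK3, mul_assoc]
      refine mul_le_mul_right ?_ _
      rw [← setLIntegral_const, ← lintegral_const_mul' _ _ ENNReal.ofReal_ne_top]
      refine setLIntegral_mono' hBm fun x hx => ?_
      rw [← ENNReal.ofReal_mul (by positivity)]
      exact ENNReal.ofReal_le_ofReal (h3 x (hB hx))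
    · refine measure_le_mul_of_locally (fun x₀ => ?_) hA
      obtain ⟨U, hUo, hxU, h1, h2, h3⟩ := exists_ball_graphMap_approx hγ x₀ hε
      refine ⟨U, hUo, hxU, fun B hB hBm => ?_⟩
      rw [e1 B hBm, e2 B hBm]
      have := euclideanHausdorffMeasure_image_le_of_dist_le (g := graphMap γ)
        (f := graphMap (fderiv ℝ γ x₀)) (A := B) (K := (1 + ε).toNNReal) 2 (by
          intro x hx y hy
          rw [Real.coe_toNNReal _ (by positivity)]
          refine dist_graphMap_le_of_abs_le hε.le ?_
          rw [abs_sub_comm]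
          exact h1 x (hB hx) y (hB hy))
      rw [hlin, hK] at this
      rw [hK3, mul_comm (ENNReal.ofReal ((1 + ε) ^ 2)), mul_assoc]
      refine le_trans ?_ (mul_le_mul_right this _)
      rw [← setLIntegral_const, ← lintegral_const_mul' _ _ ENNReal.ofReal_ne_top]
      refine setLIntegral_mono' hBm fun x hx => ?_
      rw [← ENNReal.ofReal_mul (by positivity)]
      exact ENNReal.ofReal_le_ofReal (h2 x (hB hx))
  have hlim : ∀ a : ENNReal, Tendsto (fun ε : ℝ => ENNReal.ofReal ((1 + ε) ^ 3) * a) (𝓝[>] 0)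
      (𝓝 a) := by
    intro a
    have h0 : Tendsto (fun ε : ℝ => ENNReal.ofReal ((1 + ε) ^ 3)) (𝓝[>] 0) (𝓝 1) := by
      have : Continuous fun ε : ℝ => ENNReal.ofReal ((1 + ε) ^ 3) :=
        ENNReal.continuous_ofReal.comp (by fun_prop)
      have h1 := (this.tendsto 0).mono_left (nhdsWithin_le_nhds (s := Set.Ioi 0))
      simpa using h1
    simpa using ENNReal.Tendsto.mul_const h0 (Or.inl one_ne_zero)
  refine le_antisymm (ge_of_tendsto (hlim _) ?_) (ge_of_tendsto (hlim _) ?_)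
  · filter_upwards [self_mem_nhdsWithin] with ε hε using (key ε hε).1
  · filter_upwards [self_mem_nhdsWithin] with ε hε using (key ε hε).2

theorem restrict_range_graphMap {γ : E2 → ℝ} (hγ : ContDiff ℝ 1 γ) :
    (μHE[2] : Measure E3).restrict (Set.range (graphMap γ))
      = (volume.withDensity fun x => ENNReal.ofReal (graphJacobian γ x)).map (graphMap γ) := by
  have hme := measurableEmbedding_graphMap hγ.continuous
  ext B hB
  rw [Measure.restrict_apply hB, Measure.map_apply hme.measurable hB,
    withDensity_apply _ (hme.measurable hB),
    ← euclideanHausdorffMeasure_graphMap_image hγ (hme.measurable hB),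
    Set.image_preimage_eq_inter_range]

theorem setIntegral_range_graphMap {γ : E2 → ℝ} (hγ : ContDiff ℝ 1 γ) (f : E3 → ℂ) :
    ∫ x in Set.range (graphMap γ), f x ∂(μHE[2] : Measure E3)
      = ∫ x, (graphJacobian γ x : ℂ) * f (graphMap γ x) := by
  have hme := measurableEmbedding_graphMap hγ.continuous
  rw [restrict_range_graphMap hγ, hme.integral_map]
  have hm : Measurable fun x => (graphJacobian γ x).toNNReal :=
    (continuous_graphJacobian hγ).measurable.real_toNNReal
  have h := integral_withDensity_eq_integral_smul (μ := (volume : Measure E2)) hm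
    (fun x => f (graphMap γ x))
  refine h.trans (integral_congr_ae (Eventually.of_forall fun x => ?_))
  simp only [NNReal.smul_def, Real.coe_toNNReal _ (graphJacobian_pos γ x).le, Complex.real_smul]

/-! ### The divergence theorem above a graph -/

/-- The projection of three-space to the plane of the first two coordinates. -/
def proj2 (x : E3) : E2 := !₂[x 0, x 1]

/-- The point of three-space with the given first two coordinates and height. -/
def join3 (x : E2) (t : ℝ) : E3 := !₂[x 0, x 1, t]

theorem contDiff_proj2 {n : WithTop ℕ∞} : ContDiff ℝ n proj2 := by
  rw [contDiff_piLp]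
  intro i
  fin_cases i <;> simp [proj2] <;> fun_prop

theorem contDiff_join3 {n : WithTop ℕ∞} : ContDiff ℝ n fun q : E2 × ℝ => join3 q.1 q.2 := by
  rw [contDiff_piLp]
  intro i
  fin_cases i <;> simp [join3] <;> fun_prop

theorem measurePreserving_join3 : MeasurePreserving fun q : E2 × ℝ => join3 q.1 q.2 := by
  have h1 : MeasurePreserving (fun q : E2 × ℝ => (q.2, WithLp.ofLp q.1)) :=
    ((MeasurePreserving.id volume).prod (PiLp.volume_preserving_ofLp (Fin 2))).comp
      Measure.measurePreserving_swap
  have h2 := (volume_preserving_piFinSuccAbove (fun _ : Fin 3 => ℝ) 2).symm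
  have h3 := PiLp.volume_preserving_toLp (Fin 3)
  have h4 := (h3.comp h2).comp h1
  convert h4 using 1
  funext q
  ext i
  fin_cases i <;> simp [join3, MeasurableEquiv.piFinSuccAbove, Fin.insertNthEquiv, Fin.insertNth,
    Fin.succAboveCases]

/-- `join3` as a continuous linear map. -/
def join3L : E2 × ℝ →L[ℝ] E3 :=
  LinearMap.toContinuousLinearMap
    { toFun := fun q => join3 q.1 q.2
      map_add' := fun x y => by ext i; fin_cases i <;> simp [join3]
      map_smul' := fun c x => by ext i; fin_cases i <;> simp [join3] }

theorem join3L_apply (q : E2 × ℝ) : join3L q = join3 q.1 q.2 := rfl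

/-- The shear `(x, t) ↦ (x, γ x + t)`. -/
def graphShear {γ : E2 → ℝ} (hγ : Continuous γ) : E2 × ℝ ≃ₜ E3 where
  toFun q := join3 q.1 (γ q.1 + q.2)
  invFun y := (proj2 y, y 2 - γ (proj2 y))
  left_inv q := by
    have : proj2 (join3 q.1 (γ q.1 + q.2)) = q.1 := by
      ext i; fin_cases i <;> simp [proj2, join3]
    ext1
    · exact this
    · simp only [this]; simp [join3]
  right_inv y := by
    ext i; fin_cases i <;> simp [proj2, join3]
  continuous_toFun := by
    have h := (contDiff_join3 (n := 0)).continuous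
    exact h.comp (by fun_prop : Continuous fun q : E2 × ℝ => (q.1, γ q.1 + q.2))
  continuous_invFun := by
    have h := (contDiff_proj2 (n := 0)).continuous
    fun_prop

theorem measurePreserving_graphShear {γ : E2 → ℝ} (hγ : Continuous γ) :
    MeasurePreserving (graphShear hγ) := by
  have h : MeasurePreserving (fun q : E2 × ℝ => (q.1, γ q.1 + q.2)) := by
    refine MeasurePreserving.skew_product (g := fun x t => γ x + t) (MeasurePreserving.id volume)
      (by fun_prop) (Eventually.of_forall fun x => ?_)
    exact (measurePreserving_add_left volume (γ x)).map_eq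
  exact measurePreserving_join3.comp h

theorem integral_fderiv_eq_zero_of_hasCompactSupport {E : Type*} [NormedAddCommGroup E]
    [InnerProductSpace ℝ E] [FiniteDimensional ℝ E] [MeasurableSpace E] [BorelSpace E] {f : E → ℂ}
    (hf : ContDiff ℝ 1 f) (hc : HasCompactSupport f) (v : E) : ∫ x, fderiv ℝ f x v = 0 := by
  have h1 : Integrable fun x => fderiv ℝ f x v :=
    ((hf.continuous_fderiv one_ne_zero).clm_apply continuous_const).integrable_of_hasCompactSupport
      (hc.fderiv_apply (𝕜 := ℝ) v)
  -- Integration by parts against the constant `1`, whose derivative vanishes.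
  have h := integral_mul_fderiv_eq_neg_fderiv_mul_of_integrable (𝕜 := ℂ) (μ := (volume : Measure E))
    (f := fun _ => (1 : ℂ)) (g := f) (v := v) (by simp)
    (by simpa using h1) (by simpa using hf.continuous.integrable_of_hasCompactSupport hc)
    (by fun_prop) (fun x _ => hf.differentiable one_ne_zero x)
  simpa using h

/-- The shear flattens the region to a half-space and preserves volume. By the chain rule the
`v`-derivative of `f` becomes a horizontal derivative of `F`, which integrates to zero on each
slice, plus a multiple of the vertical one. That coefficient does not depend on the height, so the
fundamental theorem of calculus in `t` leaves only the boundary value `-F (x, 0)`. -/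
theorem setIntegral_fderiv_above_graph {γ : E2 → ℝ} (hγ : ContDiff ℝ 1 γ) {f : E3 → ℂ}
    (hf : ContDiff ℝ 1 f) (hc : HasCompactSupport f) (v : E3) :
    ∫ y in {y : E3 | γ (proj2 y) < y 2}, fderiv ℝ f y v
      = ∫ x : E2, ((fderiv ℝ γ x (proj2 v) - v 2 : ℝ) : ℂ) * f (graphMap γ x) := by
  set S := graphShear hγ.continuous with hS
  have hSe : ∀ q, S q = join3 q.1 (γ q.1 + q.2) := fun q => rfl
  have hSd : ContDiff ℝ 1 S := by
    have h := contDiff_join3 (n := 1)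
    exact h.comp (by fun_prop : ContDiff ℝ 1 fun q : E2 × ℝ => (q.1, γ q.1 + q.2))
  set F : E2 × ℝ → ℂ := fun q => f (S q) with hF
  have hFd : ContDiff ℝ 1 F := hf.comp hSd
  have hFc : HasCompactSupport F := hc.comp_homeomorph S
  have hFcont := hFd.continuous_fderiv one_ne_zero
  have hpre : S ⁻¹' {y : E3 | γ (proj2 y) < y 2} = Set.univ ×ˢ Set.Ioi (0 : ℝ) := by
    ext q
    have : proj2 (S q) = q.1 := by
      rw [hSe]; ext i; fin_cases i <;> simp [proj2, join3]
    simp only [Set.mem_preimage, Set.mem_ofPred_eq, this]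
    simp [hSe, join3]
  have hpt : ∀ q, fderiv ℝ f (S q) v = fderiv ℝ F q (proj2 v, 0)
      + ((v 2 - fderiv ℝ γ q.1 (proj2 v) : ℝ) : ℂ) * fderiv ℝ F q (0, 1) := by
    intro q
    have hg := (hγ.differentiable one_ne_zero q.1).hasFDerivAt
    have hDS : ∀ w : E2, ∀ a : ℝ, fderiv ℝ S q (w, a) = join3 w (fderiv ℝ γ q.1 w + a) := by
      have h2 : HasFDerivAt (fun q : E2 × ℝ => γ q.1) ((fderiv ℝ γ q.1).comp
          (ContinuousLinearMap.fst ℝ E2 ℝ)) q := hg.comp q hasFDerivAt_fst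
      have h3 := join3L.hasFDerivAt.comp q
        ((hasFDerivAt_fst (𝕜 := ℝ) (p := q)).prodMk (h2.add hasFDerivAt_snd))
      have h4 : HasFDerivAt S _ q := h3
      intro w a
      rw [h4.fderiv]
      simp [join3L_apply]
    have hDF : ∀ w, fderiv ℝ F q w = fderiv ℝ f (S q) (fderiv ℝ S q w) := by
      intro w
      rw [hF, fderiv_fun_comp _ (hf.differentiable one_ne_zero _) (hSd.differentiable one_ne_zero _)]
      rfl
    rw [hDF, hDF, hDS, hDS, ← Complex.real_smul, ← map_smul, ← map_add]
    congr 1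
    ext i; fin_cases i <;> simp [proj2, join3]
  rw [← (measurePreserving_graphShear hγ.continuous).setIntegral_preimage_emb
    S.measurableEmbedding, ← hS, hpre]
  simp_rw [hpt]
  have i1 : Integrable (fun q => fderiv ℝ F q (proj2 v, 0)) :=
    (hFcont.clm_apply continuous_const).integrable_of_hasCompactSupport
      (hFc.fderiv_apply (𝕜 := ℝ) _)
  have i2 : Integrable (fun q : E2 × ℝ => ((v 2 - fderiv ℝ γ q.1 (proj2 v) : ℝ) : ℂ)
      * fderiv ℝ F q (0, 1)) := by
    refine Continuous.integrable_of_hasCompactSupport ?_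
      (hFc.fderiv_apply (𝕜 := ℝ) _).mul_left
    have := hγ.continuous_fderiv one_ne_zero
    fun_prop
  rw [integral_add i1.integrableOn i2.integrableOn]
  have z1 : ∫ q in Set.univ ×ˢ Set.Ioi (0 : ℝ), fderiv ℝ F q (proj2 v, 0) = 0 := by
    have i1' := i1.integrableOn (s := Set.univ ×ˢ Set.Ioi (0 : ℝ))
    rw [IntegrableOn, Measure.volume_eq_prod, ← Measure.prod_restrict] at i1'
    rw [Measure.volume_eq_prod, ← Measure.prod_restrict, integral_prod_symm _ i1',
      Measure.restrict_univ]
    refine integral_eq_zero_of_ae (Eventually.of_forall fun t => ?_)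
    have hcl : IsClosedEmbedding fun x : E2 => (x, t) :=
      Function.LeftInverse.isClosedEmbedding (f := Prod.fst) (fun _ => rfl) continuous_fst
        (by fun_prop)
    have h := integral_fderiv_eq_zero_of_hasCompactSupport (f := fun x => F (x, t))
      (hFd.comp (by fun_prop)) (hFc.comp_isClosedEmbedding hcl) (proj2 v)
    refine (integral_congr_ae (Eventually.of_forall fun x => ?_)).trans h
    have h1 : HasFDerivAt (fun x => F (x, t)) _ x :=
      HasFDerivAt.comp (g := F) (f := fun x => (x, t)) x
        (hFd.differentiable one_ne_zero (x, t)).hasFDerivAt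
        ((hasFDerivAt_id (𝕜 := ℝ) x).prodMk (hasFDerivAt_const t x))
    simp only [h1.fderiv]
    simp
  have z2 : ∫ q in Set.univ ×ˢ Set.Ioi (0 : ℝ), ((v 2 - fderiv ℝ γ q.1 (proj2 v) : ℝ) : ℂ)
      * fderiv ℝ F q (0, 1)
      = ∫ x : E2, ((fderiv ℝ γ x (proj2 v) - v 2 : ℝ) : ℂ) * f (graphMap γ x) := by
    rw [Measure.volume_eq_prod, setIntegral_prod _ i2.integrableOn, setIntegral_univ]
    refine integral_congr_ae (Eventually.of_forall fun x => ?_)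
    simp only
    rw [integral_const_mul]
    have hcl : IsClosedEmbedding fun t : ℝ => (x, t) :=
      Function.LeftInverse.isClosedEmbedding (f := Prod.snd) (fun _ => rfl) continuous_snd
        (by fun_prop)
    have h := (hFc.comp_isClosedEmbedding hcl).integral_Ioi_deriv_eq
      (f := fun t => F (x, t)) (hFd.comp (by fun_prop)) 0
    have h5 : ∫ t in Set.Ioi (0 : ℝ), fderiv ℝ F (x, t) (0, 1) = -F (x, 0) := by
      refine (integral_congr_ae (Eventually.of_forall fun t => ?_)).trans h
      have h1 : HasFDerivAt (fun t => F (x, t)) _ t :=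
        HasFDerivAt.comp (g := F) (f := fun t => (x, t)) t
          (hFd.differentiable one_ne_zero (x, t)).hasFDerivAt
          ((hasFDerivAt_const x t).prodMk (hasFDerivAt_id (𝕜 := ℝ) t))
      simp only [← fderiv_apply_one_eq_deriv, h1.fderiv]
      simp
    rw [h5]
    have h6 : F (x, 0) = f (graphMap γ x) := by
      simp only [hF, hSe]
      congr 1
      ext i; fin_cases i <;> simp [join3, graphMap]
    rw [h6]
    push_cast
    ring
  rw [z1, z2, zero_add]

/-! ### Outward normals and the local divergence theorem -/

/-- If the normals differed, the direction `n - n'` would make an acute angle with `n` and an obtuse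
one with `n'`, so it would both leave the closure of `Ω` and enter `Ω`. -/
theorem IsOutwardUnitNormal.eq {Ω : Set E3} {x n n' : E3} (h : IsOutwardUnitNormal Ω x n)
    (h' : IsOutwardUnitNormal Ω x n') : n = n' := by
  by_contra hne
  have hlt : ⟪n, n'⟫ < 1 := inner_lt_one_iff_real_of_norm_eq_one h.norm_eq h'.norm_eq |>.2 hne
  have h1 : 0 < ⟪n - n', n⟫ := by
    rw [inner_sub_left, real_inner_self_eq_norm_sq, h.norm_eq, real_inner_comm]; linarith
  have h2 : ⟪n - n', n'⟫ < 0 := by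
    rw [inner_sub_left, real_inner_self_eq_norm_sq, h'.norm_eq]; linarith
  obtain ⟨t, ht1, ht2⟩ := ((h.leaves _ h1).and (h'.enters _ h2)).exists
  exact ht1 (subset_closure ht2)

theorem IsOutwardUnitNormal.outwardNormal_eq {Ω : Set E3} {x n : E3}
    (h : IsOutwardUnitNormal Ω x n) : outwardNormal Ω x = n := by
  have hex : ∃ n, IsOutwardUnitNormal Ω x n := ⟨n, h⟩
  rw [outwardNormal, dif_pos hex]
  exact hex.choose_spec.eq h

theorem eventually_neg_of_hasDerivAt {g : ℝ → ℝ} {m : ℝ} (h0 : g 0 = 0) (hg : HasDerivAt g m 0)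
    (hm : m < 0) : ∀ᶠ t in 𝓝[>] 0, g t < 0 := by
  have h1 := (hasDerivWithinAt_iff_tendsto_slope' (by simp)).1 (hg.hasDerivWithinAt (s := Set.Ioi 0))
  filter_upwards [h1.eventually (gt_mem_nhds hm), self_mem_nhdsWithin] with t ht htpos
  rw [slope_def_field, h0, sub_zero, sub_zero] at ht
  exact (div_neg_iff.1 ht).resolve_left (fun h => absurd htpos h.2.not_gt) |>.1

/-- The downward unit normal of the graph of `γ`. -/
def graphNormal (γ : E2 → ℝ) (x : E2) : E3 :=
  (graphJacobian γ x)⁻¹ • !₂[fderiv ℝ γ x (EuclideanSpace.single 0 1),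
    fderiv ℝ γ x (EuclideanSpace.single 1 1), -1]

theorem clm_apply_eq_sum (l : E2 →L[ℝ] ℝ) (w : E2) :
    l w = w 0 * l (EuclideanSpace.single 0 1) + w 1 * l (EuclideanSpace.single 1 1) := by
  have : w = w 0 • EuclideanSpace.single 0 (1 : ℝ) + w 1 • EuclideanSpace.single 1 (1 : ℝ) := by
    ext i; fin_cases i <;> simp
  conv_lhs => rw [this]
  simp

/-- The sign tells on which side of the tangent plane `d` points, and the factor `(graphJacobian γ
x)⁻¹` later cancels the surface density. -/
theorem inner_graphNormal (γ : E2 → ℝ) (x : E2) (d : E3) :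
    ⟪graphNormal γ x, d⟫ = (graphJacobian γ x)⁻¹ * (fderiv ℝ γ x (proj2 d) - d 2) := by
  rw [graphNormal, real_inner_smul_left, clm_apply_eq_sum _ (proj2 d)]
  have h0 : proj2 d 0 = d 0 := rfl
  have h1 : proj2 d 1 = d 1 := rfl
  rw [h0, h1]
  simp only [PiLp.inner_apply, Fin.sum_univ_three]
  simp
  left
  ring

theorem norm_graphNormal (γ : E2 → ℝ) (x : E2) : ‖graphNormal γ x‖ = 1 := by
  rw [graphNormal, norm_smul, Real.norm_eq_abs, abs_of_pos (inv_pos.2 (graphJacobian_pos γ x)),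
    EuclideanSpace.norm_eq]
  have : √(∑ i : Fin 3, ‖(!₂[fderiv ℝ γ x (EuclideanSpace.single 0 1),
      fderiv ℝ γ x (EuclideanSpace.single 1 1), -1] : E3) i‖ ^ 2) = graphJacobian γ x := by
    rw [graphJacobian]
    congr 1
    simp [Fin.sum_univ_three]
    ring
  rw [this, inv_mul_cancel₀ (graphJacobian_pos γ x).ne']

theorem continuous_graphNormal {γ : E2 → ℝ} (hγ : ContDiff ℝ 1 γ) :
    Continuous (graphNormal γ) := by
  unfold graphNormal
  have h := hγ.continuous_fderiv one_ne_zero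
  refine ((continuous_graphJacobian hγ).inv₀ fun x => (graphJacobian_pos γ x).ne').smul ?_
  refine (PiLp.continuous_toLp 2 _).comp (continuous_pi fun i => ?_)
  fin_cases i <;> simp <;> fun_prop

/-- In the open set `U`, and in the coordinates `e`, the set `Ω` is the region above the graph of
the `C¹` function `γ`. -/
structure IsGraphChart (Ω U : Set E3) (e : E3 ≃ₗᵢ[ℝ] E3) (γ : E2 → ℝ) : Prop where
  isOpen : IsOpen U
  contDiff : ContDiff ℝ 1 γ
  mem_iff : ∀ x ∈ U, x ∈ Ω ↔ γ (proj2 (e x)) < e x 2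

theorem HasC2Boundary.exists_isGraphChart {Ω : Set E3} (h : HasC2Boundary Ω) {p : E3}
    (hp : p ∈ frontier Ω) : ∃ U e γ, p ∈ U ∧ Bornology.IsBounded U ∧ IsGraphChart Ω U e γ := by
  obtain ⟨r, hr, e, γ, hγ, hU⟩ := h p hp
  refine ⟨ball p r, e, γ, mem_ball_self hr, isBounded_ball, isOpen_ball, hγ.of_le one_le_two, fun x hx => ?_⟩
  have := Set.ext_iff.1 hU x
  exact ⟨fun hxΩ => (this.1 ⟨hxΩ, hx⟩).2, fun hlt => (this.2 ⟨hx, hlt⟩).1⟩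

namespace IsGraphChart

variable {Ω U : Set E3} {e : E3 ≃ₗᵢ[ℝ] E3} {γ : E2 → ℝ}

/-- Inside the chart `γ - x₂` is a defining function of `Ω`, negative in `Ω`. The sign of this
derivative decides whether a ray from a boundary point enters or leaves. -/
theorem hasDerivAt_height (h : IsGraphChart Ω U e γ) (x : E3) (d : E3) :
    HasDerivAt (fun t : ℝ => γ (proj2 (e (x + t • d))) - e (x + t • d) 2)
      (fderiv ℝ γ (proj2 (e x)) (proj2 (e d)) - e d 2) 0 := by
  have h1 : ∀ t : ℝ, proj2 (e (x + t • d)) = proj2 (e x) + t • proj2 (e d) := by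
    intro t; ext i; fin_cases i <;> simp [proj2]
  have h2 : ∀ t : ℝ, e (x + t • d) 2 = e x 2 + t * e d 2 := by
    intro t; simp
  simp_rw [h1, h2]
  have h3 : HasDerivAt (fun t : ℝ => proj2 (e x) + t • proj2 (e d)) (proj2 (e d)) 0 := by
    simpa using ((hasDerivAt_id (0 : ℝ)).smul_const (proj2 (e d))).const_add (proj2 (e x))
  have h4 : HasDerivAt (fun t : ℝ => e x 2 + t * e d 2) (e d 2) 0 := by
    simpa using ((hasDerivAt_id (0 : ℝ)).mul_const (e d 2)).const_add (e x 2)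
  have h5 := (h.contDiff.differentiable one_ne_zero (proj2 (e x))).hasFDerivAt
  have h6 : HasDerivAt (fun t : ℝ => γ (proj2 (e x) + t • proj2 (e d))) _ 0 :=
    HasFDerivAt.comp_hasDerivAt (0 : ℝ) (by simpa using h5) h3
  exact h6.sub h4

theorem continuous_height (h : IsGraphChart Ω U e γ) :
    Continuous fun x => γ (proj2 (e x)) - e x 2 := by
  have h1 := h.contDiff.continuous
  have h2 := (contDiff_proj2 (n := 0)).continuous
  have h3 := e.continuous
  fun_prop

theorem eventually_add_smul_mem (h : IsGraphChart Ω U e γ) {x : E3} (hx : x ∈ U) (d : E3) :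
    ∀ᶠ t : ℝ in 𝓝[>] 0, x + t • d ∈ U := by
  have : Continuous fun t : ℝ => x + t • d := by fun_prop
  have := (this.tendsto 0).mono_left (nhdsWithin_le_nhds (s := Set.Ioi 0))
  exact this (h.isOpen.mem_nhds (by simpa))

theorem eventually_mem (h : IsGraphChart Ω U e γ) {x : E3} (hx : x ∈ U)
    (h0 : γ (proj2 (e x)) = e x 2) {d : E3}
    (hd : fderiv ℝ γ (proj2 (e x)) (proj2 (e d)) - e d 2 < 0) :
    ∀ᶠ t : ℝ in 𝓝[>] 0, x + t • d ∈ Ω := by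
  have h1 := eventually_neg_of_hasDerivAt (by simp [h0]) (h.hasDerivAt_height x d) hd
  filter_upwards [h1, h.eventually_add_smul_mem hx d] with t ht htU
  rw [h.mem_iff _ htU]
  linarith

theorem notMem_closure (h : IsGraphChart Ω U e γ) {x : E3} (hx : x ∈ U)
    (hlt : 0 < γ (proj2 (e x)) - e x 2) : x ∉ closure Ω := by
  intro hcl
  have hV : IsOpen (U ∩ {y | 0 < γ (proj2 (e y)) - e y 2}) :=
    h.isOpen.inter (isOpen_lt continuous_const h.continuous_height)
  obtain ⟨y, ⟨hyU, hy⟩, hyΩ⟩ := _root_.mem_closure_iff.1 hcl _ hV ⟨hx, hlt⟩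
  rw [h.mem_iff y hyU] at hyΩ
  simp only [Set.mem_ofPred_eq] at hy
  linarith

theorem eventually_notMem (h : IsGraphChart Ω U e γ) {x : E3} (hx : x ∈ U)
    (h0 : γ (proj2 (e x)) = e x 2) {d : E3}
    (hd : 0 < fderiv ℝ γ (proj2 (e x)) (proj2 (e d)) - e d 2) :
    ∀ᶠ t : ℝ in 𝓝[>] 0, x + t • d ∉ closure Ω := by
  have h1 := eventually_neg_of_hasDerivAt (by simp [h0]) (h.hasDerivAt_height x d).neg
    (neg_lt_zero.2 hd)
  filter_upwards [h1, h.eventually_add_smul_mem hx d] with t ht htU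
  simp only [Pi.neg_apply] at ht
  exact h.notMem_closure htU (by linarith)

theorem mem_frontier_iff (h : IsGraphChart Ω U e γ) (hΩ : IsOpen Ω) {x : E3} (hx : x ∈ U) :
    x ∈ frontier Ω ↔ γ (proj2 (e x)) = e x 2 := by
  rw [hΩ.frontier_eq]
  constructor
  · rintro ⟨hcl, hn⟩
    rw [h.mem_iff x hx, not_lt] at hn
    by_contra hne
    exact h.notMem_closure hx (sub_pos.2 (lt_of_le_of_ne hn (Ne.symm hne))) hcl
  · intro h0
    refine ⟨?_, by rw [h.mem_iff x hx, h0]; exact lt_irrefl _⟩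
    -- The vertical direction enters `Ω`, so a point of the graph is a limit of points of `Ω`.
    have hev := h.eventually_mem hx h0 (d := e.symm (join3 0 1)) (by
      have hz : proj2 (join3 0 1) = 0 := by ext i; fin_cases i <;> simp [proj2, join3]
      rw [e.apply_symm_apply, hz, map_zero]
      simp [join3])
    have : Tendsto (fun t : ℝ => x + t • e.symm (join3 0 1)) (𝓝[>] 0) (𝓝 x) := by
      have : Continuous fun t : ℝ => x + t • e.symm (join3 0 1) := by fun_prop
      simpa using (this.tendsto 0).mono_left (nhdsWithin_le_nhds (s := Set.Ioi 0))
    exact mem_closure_of_tendsto this hev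

theorem outwardNormal_eq (h : IsGraphChart Ω U e γ) (hΩ : IsOpen Ω) {x : E3} (hx : x ∈ U)
    (hxf : x ∈ frontier Ω) : outwardNormal Ω x = e.symm (graphNormal γ (proj2 (e x))) := by
  have h0 := (h.mem_frontier_iff hΩ hx).1 hxf
  have hJ := graphJacobian_pos γ (proj2 (e x))
  have hin : ∀ d, ⟪d, e.symm (graphNormal γ (proj2 (e x)))⟫
      = (graphJacobian γ (proj2 (e x)))⁻¹
        * (fderiv ℝ γ (proj2 (e x)) (proj2 (e d)) - e d 2) := by
    intro d
    rw [← inner_graphNormal, real_inner_comm, ← e.inner_map_map, e.apply_symm_apply]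
  refine IsOutwardUnitNormal.outwardNormal_eq ⟨?_, fun d hd => ?_, fun d hd => ?_⟩
  · rw [e.symm.norm_map, norm_graphNormal]
  · rw [hin] at hd
    exact h.eventually_mem hx h0 (neg_of_mul_neg_right hd (inv_pos.2 hJ).le)
  · rw [hin] at hd
    exact h.eventually_notMem hx h0 (pos_of_mul_pos_right hd (inv_pos.2 hJ).le)

theorem mem_range_iff {x : E3} :
    e x ∈ Set.range (graphMap γ) ↔ γ (proj2 (e x)) = e x 2 := by
  constructor
  · rintro ⟨y, hy⟩
    rw [← hy]
    have : proj2 (graphMap γ y) = y := by ext i; fin_cases i <;> simp [proj2, graphMap]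
    rw [this]; simp [graphMap]
  · intro h0
    refine ⟨proj2 (e x), ?_⟩
    ext i; fin_cases i <;> simp [proj2, graphMap]
    exact h0

/-- The divergence theorem for functions supported in a chart. -/
theorem integral_fderiv_eq (h : IsGraphChart Ω U e γ) (hΩ : IsOpen Ω) {f : E3 → ℂ}
    (hf : ContDiff ℝ 1 f) (hc : HasCompactSupport f) (hs : tsupport f ⊆ U) (v : E3) :
    ∫ x in Ω, fderiv ℝ f x v
      = ∫ x, f x * (⟪outwardNormal Ω x, v⟫ : ℝ) ∂(surfaceMeasure (frontier Ω)) := by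
  have hfz : ∀ x ∉ U, f x = 0 := fun x hx => image_eq_zero_of_notMem_tsupport fun h' => hx (hs h')
  have hdz : ∀ x ∉ U, fderiv ℝ f x = 0 := fun x hx =>
    image_eq_zero_of_notMem_tsupport fun h' => hx (hs (tsupport_fderiv_subset ℝ h'))
  set f₁ : E3 → ℂ := fun y => f (e.symm y) with hf₁
  have hf₁d : ContDiff ℝ 1 f₁ := hf.comp e.symm.contDiff
  have hf₁c : HasCompactSupport f₁ := hc.comp_homeomorph e.symm.toHomeomorph
  have key := setIntegral_fderiv_above_graph h.contDiff hf₁d hf₁c (e v)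
  set A : Set E3 := {y : E3 | γ (proj2 y) < y 2} with hA
  have hAo : IsOpen A := isOpen_lt (h.contDiff.continuous.comp (contDiff_proj2 (n := 0)).continuous)
    (by fun_prop)
  have hder : ∀ x, fderiv ℝ f₁ (e x) (e v) = fderiv ℝ f x v := by
    intro x
    have h1 : HasFDerivAt f₁ _ (e x) :=
      HasFDerivAt.comp (e x) (g := f) (f := e.symm)
        (by simpa using (hf.differentiable one_ne_zero x).hasFDerivAt) e.symm.hasFDerivAt
    rw [h1.fderiv]
    exact congrArg _ (e.symm_apply_apply v)
  -- Outside `U` the integrand vanishes, so it is enough that `Ω` and the region above the graph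
  -- agree in `U`. The surface integral below is treated in the same way.
  have hL : ∫ x in Ω, fderiv ℝ f x v = ∫ y in A, fderiv ℝ f₁ y (e v) := by
    rw [← e.measurePreserving.setIntegral_preimage_emb
      e.toHomeomorph.measurableEmbedding (fun y => fderiv ℝ f₁ y (e v)) A]
    simp only [hder]
    rw [← integral_indicator hΩ.measurableSet,
      ← integral_indicator (hAo.preimage e.continuous).measurableSet]
    congr 1
    funext x
    by_cases hx : x ∈ U
    · have : x ∈ Ω ↔ x ∈ e ⁻¹' A := h.mem_iff x hx
      by_cases hxΩ : x ∈ Ω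
      · rw [Set.indicator_of_mem hxΩ, Set.indicator_of_mem (this.1 hxΩ)]
      · rw [Set.indicator_of_notMem hxΩ, Set.indicator_of_notMem (fun h' => hxΩ (this.2 h'))]
    · rw [Set.indicator_apply_eq_zero.2 fun _ => by rw [hdz x hx]; rfl,
        Set.indicator_apply_eq_zero.2 fun _ => by rw [hdz x hx]; rfl]
  have hRm : MeasurableSet (Set.range (graphMap γ)) :=
    (measurableEmbedding_graphMap h.contDiff.continuous).measurableSet_range
  have hR : ∫ x, f x * (⟪outwardNormal Ω x, v⟫ : ℝ) ∂(surfaceMeasure (frontier Ω))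
      = ∫ y in Set.range (graphMap γ), f₁ y * (⟪graphNormal γ (proj2 y), e v⟫ : ℝ)
        ∂(μHE[2] : Measure E3) := by
    have hmp : MeasurePreserving e μHE[2] μHE[2] :=
      e.toIsometryEquiv.measurePreserving_euclideanHausdorffMeasure 2
    rw [← hmp.setIntegral_preimage_emb e.toHomeomorph.measurableEmbedding, surfaceMeasure]
    rw [← integral_indicator isClosed_frontier.measurableSet,
      ← integral_indicator (e.continuous.measurable hRm)]
    congr 1
    funext x
    by_cases hx : x ∈ U
    · have : x ∈ frontier Ω ↔ x ∈ e ⁻¹' (Set.range (graphMap γ)) :=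
        (h.mem_frontier_iff hΩ hx).trans mem_range_iff.symm
      by_cases hxΩ : x ∈ frontier Ω
      · rw [Set.indicator_of_mem hxΩ, Set.indicator_of_mem (this.1 hxΩ),
          h.outwardNormal_eq hΩ hx hxΩ, ← e.inner_map_map, e.apply_symm_apply]
        simp [hf₁]
      · rw [Set.indicator_of_notMem hxΩ]
        exact (Set.indicator_of_notMem (fun h' => hxΩ (this.2 h')) _).symm
    · have : f₁ (e x) = 0 := by simp [hf₁, hfz x hx]
      rw [Set.indicator_apply_eq_zero.2 fun _ => by rw [hfz x hx, zero_mul],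
        Set.indicator_apply_eq_zero.2 fun _ => by rw [this, zero_mul]]
  rw [hL, key, hR, setIntegral_range_graphMap h.contDiff]
  congr 1
  funext x
  have : proj2 (graphMap γ x) = x := by ext i; fin_cases i <;> simp [proj2, graphMap]
  -- The surface density cancels against the normalisation of the normal.
  rw [this, inner_graphNormal]
  have hJ := (graphJacobian_pos γ x).ne'
  push_cast
  have : (graphJacobian γ x : ℂ) ≠ 0 := by exact_mod_cast hJ
  field_simp

end IsGraphChart

/-! ### The divergence theorem on a bounded domain with `C²` boundary -/

namespace IsBoundedC2Domain

variable {Ω : Set E3}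

theorem isCompact_closure (hΩ : IsBoundedC2Domain Ω) : IsCompact (closure Ω) :=
  hΩ.isBounded.isCompact_closure

theorem isCompact_frontier (hΩ : IsBoundedC2Domain Ω) : IsCompact (frontier Ω) :=
  hΩ.isCompact_closure.of_isClosed_subset isClosed_frontier frontier_subset_closure

/-- It localises the divergence theorem to pieces supported either inside `Ω` or in one chart.
Compactness of the closure gives finitely many pieces, and bounded neighbourhoods give compact
supports. -/
theorem exists_smooth_partition (hΩ : IsBoundedC2Domain Ω) :
    ∃ (ι : Type) (_ : Fintype ι) (χ : ι → E3 → ℝ), (∀ i, ContDiff ℝ 1 (χ i)) ∧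
      (∀ i, HasCompactSupport (χ i)) ∧
      (∀ i, tsupport (χ i) ⊆ Ω ∨ ∃ U e γ, IsGraphChart Ω U e γ ∧ tsupport (χ i) ⊆ U) ∧
      ∀ x ∈ closure Ω, ∑ i, χ i x = 1 := by
  have hex : ∀ p : E3, ∃ V : Set E3, IsOpen V ∧ Bornology.IsBounded V ∧ (p ∈ closure Ω → p ∈ V) ∧
      (V ⊆ Ω ∨ ∃ U e γ, IsGraphChart Ω U e γ ∧ V ⊆ U) := by
    intro p
    by_cases hp : p ∈ frontier Ω
    · obtain ⟨U, e, γ, hpU, hb, h⟩ := hΩ.c2.exists_isGraphChart hp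
      exact ⟨U, h.isOpen, hb, fun _ => hpU, Or.inr ⟨U, e, γ, h, subset_rfl⟩⟩
    -- For `p` outside the closure `Ω` is only a default value, since membership is asked only of
    -- points of the closure.
    · refine ⟨Ω, hΩ.isOpen, hΩ.isBounded, fun h => ?_, Or.inl subset_rfl⟩
      rw [hΩ.isOpen.frontier_eq] at hp
      by_contra h'
      exact hp ⟨h, h'⟩
  choose V hVo hVb hVm hV using hex
  obtain ⟨t, ht, hcov⟩ := hΩ.isCompact_closure.elim_nhds_subcover V
    fun x hx => (hVo x).mem_nhds (hVm x hx)
  obtain ⟨n, ⟨g⟩⟩ : ∃ n, Nonempty (Fin n ≃ t) := ⟨_, ⟨(Fintype.equivFin t).symm⟩⟩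
  obtain ⟨χ, hχ⟩ := SmoothPartitionOfUnity.exists_isSubordinate (modelWithCornersSelf ℝ E3)
    (s := closure Ω) isClosed_closure (fun i : Fin n => V (g i)) (fun i => hVo _) (by
      intro x hx
      obtain ⟨y, hy, hxy⟩ := Set.mem_iUnion₂.1 (hcov hx)
      refine Set.mem_iUnion.2 ⟨g.symm ⟨y, hy⟩, ?_⟩
      simpa using hxy)
  refine ⟨Fin n, inferInstance, fun i => χ i, fun i => ?_, fun i => ?_, fun i => ?_, fun x hx => ?_⟩
  · exact (χ i).contMDiff.contDiff.of_le (by exact_mod_cast le_top)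
  · exact Metric.isCompact_of_isClosed_isBounded (isClosed_tsupport _) ((hVb _).subset (hχ i))
  · rcases hV (g i) with h | ⟨U, e, γ, h, hU⟩
    · exact Or.inl ((hχ i).trans h)
    · exact Or.inr ⟨U, e, γ, h, (hχ i).trans hU⟩
  · rw [← finsum_eq_sum_of_fintype]
    exact χ.sum_eq_one hx

theorem notMem_of_mem_frontier (hΩ : IsBoundedC2Domain Ω) {x : E3} (hx : x ∈ frontier Ω) :
    x ∉ Ω := by
  rw [hΩ.isOpen.frontier_eq] at hx
  exact hx.2

/-- The normal field is chosen point by point, so its regularity has to come from the chart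
formulas, glued by the partition of unity. A continuous field on the whole space makes measurability
and integrability on the boundary immediate. -/
theorem exists_continuous_eq_outwardNormal (hΩ : IsBoundedC2Domain Ω) :
    ∃ G : E3 → E3, Continuous G ∧ ∀ x ∈ frontier Ω, outwardNormal Ω x = G x := by
  obtain ⟨ι, _, χ, hχ, hc, hloc, hsum⟩ := hΩ.exists_smooth_partition
  have : ∀ i, ∃ G : E3 → E3, Continuous G ∧
      ∀ x ∈ frontier Ω, χ i x • outwardNormal Ω x = G x := by
    intro i
    rcases hloc i with h | ⟨U, e, γ, h, hU⟩
    · refine ⟨0, continuous_zero, fun x hx => ?_⟩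
      rw [image_eq_zero_of_notMem_tsupport fun h' => hΩ.notMem_of_mem_frontier hx (h h')]
      simp
    · refine ⟨fun x => χ i x • e.symm (graphNormal γ (proj2 (e x))), ?_, fun x hx => ?_⟩
      · have h1 := (hχ i).continuous
        have h2 := continuous_graphNormal h.contDiff
        have h3 := (contDiff_proj2 (n := 0)).continuous
        have h4 := e.continuous
        have h5 := e.symm.continuous
        fun_prop
      · by_cases hxU : x ∈ U
        · rw [h.outwardNormal_eq hΩ.isOpen hxU hx]
        · have h0 := image_eq_zero_of_notMem_tsupport fun h' => hxU (hU h')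
          simp only [h0, zero_smul]
  choose G hG hGx using this
  refine ⟨fun x => ∑ i, G i x, continuous_finsetSum _ fun i _ => hG i, fun x hx => ?_⟩
  change _ = ∑ i, G i x
  rw [← Finset.sum_congr rfl fun i _ => hGx i x hx, ← Finset.sum_smul,
    hsum x (frontier_subset_closure hx), one_smul]

/-- Near each point the frontier lies in an isometric copy of a graph over a compact set, where the
continuous Jacobian is integrable. Compactness of the frontier concludes. -/
theorem isFiniteMeasure_surfaceMeasure (hΩ : IsBoundedC2Domain Ω) :
    IsFiniteMeasure (surfaceMeasure (frontier Ω)) := by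
  refine ⟨?_⟩
  rw [surfaceMeasure, Measure.restrict_apply_univ]
  refine hΩ.isCompact_frontier.measure_lt_top_of_nhdsWithin fun x hx => ?_
  obtain ⟨U, e, γ, hxU, -, h⟩ := hΩ.c2.exists_isGraphChart hx
  obtain ⟨r, hr, hrU⟩ := nhds_basis_closedBall.mem_iff.1 (h.isOpen.mem_nhds hxU)
  refine ⟨closedBall x r ∩ frontier Ω, inter_mem (nhdsWithin_le_nhds (closedBall_mem_nhds x hr))
    self_mem_nhdsWithin, ?_⟩
  set K : Set E2 := (fun y => proj2 (e y)) '' closedBall x r with hK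
  have hKc : IsCompact K := (isCompact_closedBall x r).image
    ((contDiff_proj2 (n := 0)).continuous.comp e.continuous)
  have hsub : closedBall x r ∩ frontier Ω ⊆ e.symm '' (graphMap γ '' K) := by
    rintro y ⟨hy, hyf⟩
    obtain ⟨z, hz⟩ := IsGraphChart.mem_range_iff.2 ((h.mem_frontier_iff hΩ.isOpen (hrU hy)).1 hyf)
    refine ⟨e y, ⟨z, ⟨y, hy, ?_⟩, hz⟩, e.symm_apply_apply y⟩
    simp only
    rw [← hz]
    ext i; fin_cases i <;> simp [proj2, graphMap]
  refine (measure_mono hsub).trans_lt ?_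
  rw [e.symm.isometry.euclideanHausdorffMeasure_image,
    euclideanHausdorffMeasure_graphMap_image h.contDiff hKc.measurableSet]
  have hint := (continuous_graphJacobian h.contDiff).continuousOn.integrableOn_compact
    (μ := volume) hKc
  exact (lintegral_mono fun x => Real.ofReal_le_enorm _).trans_lt hint.2

theorem integrable_surfaceMeasure (hΩ : IsBoundedC2Domain Ω) {f : E3 → ℂ} (hf : Continuous f) :
    Integrable f (surfaceMeasure (frontier Ω)) := by
  have := hΩ.isFiniteMeasure_surfaceMeasure
  obtain ⟨C, hC⟩ := hΩ.isCompact_frontier.exists_bound_of_continuousOn hf.continuousOn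
  refine Integrable.of_bound hf.aestronglyMeasurable C ?_
  rw [surfaceMeasure, ae_restrict_iff' isClosed_frontier.measurableSet]
  exact Eventually.of_forall hC

theorem integral_fderiv_eq_of_tsupport_subset (hΩ : IsBoundedC2Domain Ω) {f : E3 → ℂ}
    (hf : ContDiff ℝ 1 f) (hc : HasCompactSupport f) (hs : tsupport f ⊆ Ω) (v : E3) :
    ∫ x in Ω, fderiv ℝ f x v
      = ∫ x, f x * (⟪outwardNormal Ω x, v⟫ : ℝ) ∂(surfaceMeasure (frontier Ω)) := by
  rw [setIntegral_eq_integral_of_forall_compl_eq_zero,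
    integral_fderiv_eq_zero_of_hasCompactSupport hf hc v, surfaceMeasure,
    setIntegral_eq_zero_of_forall_eq_zero]
  · intro x hx
    rw [image_eq_zero_of_notMem_tsupport fun h' => hΩ.notMem_of_mem_frontier hx (hs h'), zero_mul]
  · intro x hx
    rw [image_eq_zero_of_notMem_tsupport fun h' => hx (hs (tsupport_fderiv_subset ℝ h'))]
    rfl

/-- The divergence theorem. -/
theorem integral_fderiv_eq (hΩ : IsBoundedC2Domain Ω) {f : E3 → ℂ} (hf : ContDiff ℝ 1 f) (v : E3) :
    ∫ x in Ω, fderiv ℝ f x v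
      = ∫ x, f x * (⟪outwardNormal Ω x, v⟫ : ℝ) ∂(surfaceMeasure (frontier Ω)) := by
  obtain ⟨ι, _, χ, hχ, hc, hloc, hsum⟩ := hΩ.exists_smooth_partition
  obtain ⟨G, hG, hGx⟩ := hΩ.exists_continuous_eq_outwardNormal
  set F : ι → E3 → ℂ := fun i x => (χ i x : ℂ) * f x with hF
  have hFd : ∀ i, ContDiff ℝ 1 (F i) := fun i => (Complex.ofRealCLM.contDiff.comp (hχ i)).mul hf
  have hsub : ∀ i, tsupport (F i) ⊆ tsupport (χ i) := by
    intro i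
    refine closure_mono fun x hx => ?_
    simp only [Function.mem_support, hF] at hx ⊢
    intro h0
    simp [h0] at hx
  have hFc : ∀ i, HasCompactSupport (F i) := fun i =>
    (hc i).of_isClosed_subset (isClosed_tsupport _) (hsub i)
  have hi : ∀ i, ∫ x in Ω, fderiv ℝ (F i) x v
      = ∫ x, F i x * (⟪outwardNormal Ω x, v⟫ : ℝ) ∂(surfaceMeasure (frontier Ω)) := by
    intro i
    rcases hloc i with h | ⟨U, e, γ, h, hU⟩
    · exact hΩ.integral_fderiv_eq_of_tsupport_subset (hFd i) (hFc i) ((hsub i).trans h) v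
    · exact h.integral_fderiv_eq hΩ.isOpen (hFd i) (hFc i) ((hsub i).trans hU) v
  have hFsum : ∀ x ∈ closure Ω, ∑ i, F i x = f x := by
    intro x hx
    rw [← Finset.sum_mul, ← Complex.ofReal_sum, hsum x hx]
    simp
  have hL : ∫ x in Ω, fderiv ℝ f x v = ∑ i, ∫ x in Ω, fderiv ℝ (F i) x v := by
    rw [← integral_finsetSum]
    · refine setIntegral_congr_fun hΩ.isOpen.measurableSet fun x hx => ?_
      -- The identity `f = ∑ F i` holds only on the closure, but `Ω` is open, so it can be
      -- differentiated at points of `Ω`.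
      have h1 : f =ᶠ[𝓝 x] fun y => ∑ i, F i y := by
        filter_upwards [hΩ.isOpen.mem_nhds hx] with y hy
        rw [hFsum y (subset_closure hy)]
      rw [h1.fderiv_eq, fderiv_fun_sum fun i _ => (hFd i).differentiable one_ne_zero x]
      simp
    · intro i _
      exact (((hFd i).continuous_fderiv one_ne_zero).clm_apply
        continuous_const).integrable_of_hasCompactSupport ((hFc i).fderiv_apply (𝕜 := ℝ) v)
        |>.integrableOn
  have hcong : ∀ g : E3 → ℂ, ∀ x ∈ frontier Ω, g x * (⟪outwardNormal Ω x, v⟫ : ℝ)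
      = g x * (⟪G x, v⟫ : ℝ) := fun g x hx => by rw [hGx x hx]
  have hR : ∀ g : E3 → ℂ, ∫ x, g x * (⟪outwardNormal Ω x, v⟫ : ℝ) ∂(surfaceMeasure (frontier Ω))
      = ∫ x, g x * (⟪G x, v⟫ : ℝ) ∂(surfaceMeasure (frontier Ω)) := fun g =>
    setIntegral_congr_fun isClosed_frontier.measurableSet (hcong g)
  rw [hL, Finset.sum_congr rfl fun i _ => (hi i).trans (hR _), hR, ← integral_finsetSum]
  · refine setIntegral_congr_fun isClosed_frontier.measurableSet fun x hx => ?_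
    rw [← Finset.sum_mul, hFsum x (frontier_subset_closure hx)]
  · intro i _
    have := (hFd i).continuous
    exact hΩ.integrable_surfaceMeasure (by fun_prop)

end IsBoundedC2Domain

/-! ### Green's formula and the representation of the boundary form -/

/-- By the Cauchy–Schwarz inequality. It carries Green's formula from smooth functions to `u` and
its trace. -/
theorem tendsto_integral_mul_of_tendsto_eLpNorm {α : Type*} [MeasurableSpace α] {μ : Measure α}
    {h g : α → ℂ} {φ : ℕ → α → ℂ} (hh : MemLp h 2 μ) (hφ : ∀ n, MemLp (φ n) 2 μ)
    (hg : MemLp g 2 μ)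
    (hlim : Tendsto (fun n => eLpNorm (fun x => φ n x - g x) 2 μ) atTop (𝓝 0)) :
    Tendsto (fun n => ∫ x, h x * φ n x ∂μ) atTop (𝓝 (∫ x, h x * g x ∂μ)) := by
  refine tendsto_integral_of_L1' _ (hh.integrable_mul hg).aestronglyMeasurable
    (Eventually.of_forall fun n => hh.integrable_mul (hφ n)) ?_
  have hb : ∀ n, eLpNorm ((fun x => h x * φ n x) - fun x => h x * g x) 1 μ
      ≤ eLpNorm h 2 μ * eLpNorm (fun x => φ n x - g x) 2 μ := by
    intro n
    have := eLpNorm_smul_le_mul_eLpNorm (p := 2) (q := 2) (r := 1) (μ := μ) (φ := h)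
      (f := fun x => φ n x - g x) ((hφ n).1.sub hg.1) hh.1
    refine le_of_eq_of_le ?_ this
    congr 1
    funext x
    simp [mul_sub]
  refine tendsto_of_tendsto_of_tendsto_of_le_of_le tendsto_const_nhds ?_ (fun _ => zero_le) hb
  simpa using ENNReal.Tendsto.const_mul hlim (Or.inr hh.2.ne)

/-- The Laplacian as the sum of the pure second partial derivatives. -/
def laplace (w : E3 → ℂ) (x : E3) : ℂ := ∑ i, partialDeriv i (partialDeriv i w) x

theorem contDiff_partialDeriv {n m : WithTop ℕ∞} {w : E3 → ℂ} (hw : ContDiff ℝ n w)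
    (hmn : m + 1 ≤ n) (i : Fin 3) : ContDiff ℝ m (partialDeriv i w) :=
  (hw.fderiv_right hmn).clm_apply contDiff_const

theorem fderiv_apply_eq_sum (l : E3 →L[ℝ] ℂ) (v : E3) :
    l v = ∑ i, (v i : ℂ) * l (EuclideanSpace.single i 1) := by
  conv_lhs => rw [← (EuclideanSpace.basisFun (Fin 3) ℝ).sum_repr v]
  simp

namespace IsBoundedC2Domain

variable {Ω : Set E3}

theorem memLp_volume (hΩ : IsBoundedC2Domain Ω) {f : E3 → ℂ} (hf : Continuous f) :
    MemLp f 2 (volume.restrict Ω) := by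
  have : IsFiniteMeasure ((volume : Measure E3).restrict Ω) :=
    ⟨by simpa using hΩ.isBounded.measure_lt_top⟩
  obtain ⟨C, hC⟩ := hΩ.isCompact_closure.exists_bound_of_continuousOn hf.continuousOn
  refine MemLp.of_bound hf.aestronglyMeasurable C ?_
  rw [ae_restrict_iff' hΩ.isOpen.measurableSet]
  exact Eventually.of_forall fun x hx => hC x (subset_closure hx)

theorem memLp_surfaceMeasure (hΩ : IsBoundedC2Domain Ω) {f : E3 → ℂ} (hf : Continuous f) :
    MemLp f 2 (surfaceMeasure (frontier Ω)) := by
  have := hΩ.isFiniteMeasure_surfaceMeasure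
  obtain ⟨C, hC⟩ := hΩ.isCompact_frontier.exists_bound_of_continuousOn hf.continuousOn
  refine MemLp.of_bound hf.aestronglyMeasurable C ?_
  rw [surfaceMeasure, ae_restrict_iff' isClosed_frontier.measurableSet]
  exact Eventually.of_forall hC

/-- The divergence theorem applied to `(∂ᵢw) φ` in the direction `i`, summed over `i`. -/
theorem integral_normalDeriv_mul (hΩ : IsBoundedC2Domain Ω) {w φ : E3 → ℂ} (hw : ContDiff ℝ 2 w)
    (hφ : ContDiff ℝ 1 φ) :
    ∫ x, normalDeriv Ω w x * φ x ∂(surfaceMeasure (frontier Ω))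
      = (∑ i, ∫ x in Ω, partialDeriv i w x * partialDeriv i φ x)
        + ∫ x in Ω, laplace w x * φ x := by
  have hw1 : ∀ i, ContDiff ℝ 1 (partialDeriv i w) := fun i =>
    contDiff_partialDeriv hw (by norm_num) i
  obtain ⟨G, hG, hGx⟩ := hΩ.exists_continuous_eq_outwardNormal
  have hdiv : ∀ i, ∫ x, (partialDeriv i w x * φ x) * (G x i : ℂ) ∂(surfaceMeasure (frontier Ω))
      = (∫ x in Ω, partialDeriv i w x * partialDeriv i φ x)
        + ∫ x in Ω, partialDeriv i (partialDeriv i w) x * φ x := by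
    intro i
    have h := hΩ.integral_fderiv_eq ((hw1 i).mul hφ) (EuclideanSpace.single i 1)
    have h1 : ∫ x, (partialDeriv i w x * φ x) * (G x i : ℂ) ∂(surfaceMeasure (frontier Ω))
        = ∫ x, (partialDeriv i w x * φ x) *
          (⟪outwardNormal Ω x, EuclideanSpace.single i 1⟫ : ℝ) ∂(surfaceMeasure (frontier Ω)) := by
      refine setIntegral_congr_fun isClosed_frontier.measurableSet fun x hx => ?_
      simp only [hGx x hx, EuclideanSpace.inner_single_right]
      simp
    rw [h1, ← h, ← integral_add]
    · refine integral_congr_ae (Eventually.of_forall fun x => ?_)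
      simp only
      rw [fderiv_fun_mul ((hw1 i).differentiable one_ne_zero x) (hφ.differentiable one_ne_zero x)]
      simp [partialDeriv]
      ring
    · exact (hΩ.memLp_volume (hw1 i).continuous).integrable_mul (hΩ.memLp_volume
        (contDiff_partialDeriv (m := 0) hφ (by norm_num) i).continuous)
    · exact (hΩ.memLp_volume (contDiff_partialDeriv (m := 0) (hw1 i)
        (by norm_num) i).continuous).integrable_mul (hΩ.memLp_volume hφ.continuous)
  have h2 : ∫ x, normalDeriv Ω w x * φ x ∂(surfaceMeasure (frontier Ω))
      = ∑ i, ∫ x, (partialDeriv i w x * φ x) * (G x i : ℂ) ∂(surfaceMeasure (frontier Ω)) := by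
    rw [← integral_finsetSum]
    · refine setIntegral_congr_fun isClosed_frontier.measurableSet fun x hx => ?_
      simp only [normalDeriv, hGx x hx]
      rw [fderiv_apply_eq_sum, Finset.sum_mul]
      refine Finset.sum_congr rfl fun i _ => ?_
      rw [partialDeriv]
      ring
    · intro i _
      have h3 := (hw1 i).continuous
      have h4 := hφ.continuous
      exact hΩ.integrable_surfaceMeasure (by fun_prop)
  rw [h2, Finset.sum_congr rfl fun i _ => hdiv i, Finset.sum_add_distrib]
  congr 1
  rw [← integral_finsetSum]
  · simp only [laplace, Finset.sum_mul]
  · intro i _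
    exact (hΩ.memLp_volume (contDiff_partialDeriv (m := 0) (hw1 i)
        (by norm_num) i).continuous).integrable_mul (hΩ.memLp_volume hφ.continuous)

theorem memLp_normalDeriv (hΩ : IsBoundedC2Domain Ω) {w : E3 → ℂ} (hw : ContDiff ℝ 1 w) :
    MemLp (normalDeriv Ω w) 2 (surfaceMeasure (frontier Ω)) := by
  obtain ⟨G, hG, hGx⟩ := hΩ.exists_continuous_eq_outwardNormal
  have h := hΩ.memLp_surfaceMeasure ((hw.continuous_fderiv one_ne_zero).clm_apply hG)
  refine h.ae_eq ?_
  rw [surfaceMeasure, EventuallyEq, ae_restrict_iff' isClosed_frontier.measurableSet]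
  exact Eventually.of_forall fun x hx => by simp only [normalDeriv, hGx x hx]

theorem continuous_laplace {w : E3 → ℂ} (hw : ContDiff ℝ 2 w) : Continuous (laplace w) :=
  continuous_finsetSum _ fun i _ => (contDiff_partialDeriv (m := 0)
    (contDiff_partialDeriv (m := 1) hw (by norm_num) i) (by norm_num) i).continuous

/-- Green's formula for `u ∈ H¹(Ω)` with trace `g` and a function `w` smooth up to the boundary. -/
theorem integral_normalDeriv_mul_trace (hΩ : IsBoundedC2Domain Ω) {u : SobolevH1 Ω} {g : E3 → ℂ}
    (hg : IsTrace u g) {w : E3 → ℂ} (hw : ContDiff ℝ 2 w) :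
    ∫ x, normalDeriv Ω w x * g x ∂(surfaceMeasure (frontier Ω))
      = (∑ i, ∫ x in Ω, partialDeriv i w x * u.grad i x) + ∫ x in Ω, laplace w x * u.toFun x := by
  obtain ⟨φ, hφ, h0, h1, h2⟩ := hg.approx
  have hφ1 : ∀ n, ContDiff ℝ 1 (φ n) := fun n => (hφ n).of_le (by exact_mod_cast le_top)
  have hw1 : ∀ i, Continuous (partialDeriv i w) := fun i =>
    (contDiff_partialDeriv (m := 0) hw (by norm_num) i).continuous
  have hL := tendsto_integral_mul_of_tendsto_eLpNorm
    (hΩ.memLp_normalDeriv (hw.of_le one_le_two))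
    (fun n => hΩ.memLp_surfaceMeasure (hφ n).continuous) hg.memLp h2
  have hR0 := tendsto_integral_mul_of_tendsto_eLpNorm (hΩ.memLp_volume (continuous_laplace hw))
    (fun n => hΩ.memLp_volume (hφ n).continuous) u.memLp h0
  have hR1 := fun i => tendsto_integral_mul_of_tendsto_eLpNorm (hΩ.memLp_volume (hw1 i))
    (fun n => hΩ.memLp_volume
      (contDiff_partialDeriv (m := 0) (hφ1 n) (by norm_num) i).continuous) (u.memLp_grad i) (h1 i)
  -- Both sides are continuous in `φ` for the convergences that define the trace.
  refine tendsto_nhds_unique hL ?_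
  refine Tendsto.congr (fun n => (hΩ.integral_normalDeriv_mul hw (hφ1 n)).symm) ?_
  exact (tendsto_finsetSum _ fun i _ => hR1 i).add hR0

end IsBoundedC2Domain

/-- The fundamental lemma of the calculus of variations; it makes the choice in `weakLaplacian`
immaterial. -/
theorem HasWeakLaplacian.ae_eq {Ω : Set E3} (hΩ : IsOpen Ω) {u : SobolevH1 Ω} {f f' : E3 → ℂ}
    (h : HasWeakLaplacian u f) (h' : HasWeakLaplacian u f') : f =ᵐ[volume.restrict Ω] f' := by
  have hloc : LocallyIntegrableOn (fun x => f x - f' x) Ω (volume.restrict Ω) :=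
    ((h.memLp.sub h'.memLp).locallyIntegrable (by norm_num)).locallyIntegrableOn _
  have key := hΩ.ae_eq_zero_of_integral_contDiff_smul_eq_zero hloc (by
    intro ψ hψ hψc hψs
    set φ : E3 → ℂ := fun x => (ψ x : ℂ) with hφ
    have hφc : HasCompactSupport φ := hψc.comp_left (g := fun t : ℝ => (t : ℂ)) rfl
    have hφt : IsTestFunction Ω φ := by
      refine ⟨Complex.ofRealCLM.contDiff.comp hψ, hφc, ?_⟩
      refine (closure_mono fun x hx => ?_).trans hψs
      simpa [hφ] using hx
    have hφm : MemLp φ 2 (volume.restrict Ω) :=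
      (hφt.smooth.continuous.memLp_of_hasCompactSupport hφc).restrict Ω
    have e := (h.weak φ hφt).symm.trans (h'.weak φ hφt)
    have j1 : Integrable (fun x => f x * φ x) (volume.restrict Ω) := h.memLp.integrable_mul hφm
    have j2 : Integrable (fun x => f' x * φ x) (volume.restrict Ω) := h'.memLp.integrable_mul hφm
    rw [← sub_eq_zero, ← integral_sub j1 j2] at e
    rw [← e]
    refine integral_congr_ae (Eventually.of_forall fun x => ?_)
    simp only [hφ, Complex.real_smul]
    ring)
  filter_upwards [key, ae_restrict_mem hΩ.measurableSet] with x hx hxΩ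
  exact sub_eq_zero.1 (hx hxΩ)

theorem memLp_source {Ω D : Set E3} {ρ : E3 → ℂ} (hD : IsOpen D)
    (hρ : MemLp ρ 2 (volume.restrict D)) : MemLp (source ρ D) 2 (volume.restrict Ω) := by
  have h1 : source ρ D = D.indicator ρ := by
    funext x
    by_cases hx : x ∈ D <;> simp [source, hx]
  rw [h1]
  exact ((memLp_indicator_iff_restrict hD.measurableSet).2 hρ).restrict Ω

/-- The equation itself exhibits a square integrable Laplacian, so `weakLaplacian u` does not take
its default value. -/
theorem IsWeakSolution.hasWeakLaplacian {Ω : Set E3} {k : ℝ} {F : E3 → ℂ} {u : SobolevH1 Ω}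
    (hF : MemLp F 2 (volume.restrict Ω)) (hu : IsWeakSolution k F u) :
    HasWeakLaplacian u fun x => F x - (k : ℂ) ^ 2 * u.toFun x := by
  refine ⟨hF.sub (u.memLp.const_mul _), fun φ hφ => ?_⟩
  have h := hu φ hφ
  have hφm : MemLp φ 2 (volume.restrict Ω) :=
    (hφ.smooth.continuous.memLp_of_hasCompactSupport hφ.compact).restrict Ω
  have hφd : ∀ i, MemLp (partialDeriv i φ) 2 (volume.restrict Ω) := fun i =>
    ((contDiff_partialDeriv (m := 0) hφ.smooth (by simp) i).continuous.memLp_of_hasCompactSupport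
      (hφ.compact.fderiv_apply (𝕜 := ℝ) _)).restrict Ω
  have i1 : Integrable (fun x => ∑ i, u.grad i x * partialDeriv i φ x) (volume.restrict Ω) :=
    integrable_finsetSum _ fun i _ => (u.memLp_grad i).integrable_mul (hφd i)
  have i2 : Integrable (fun x => (k : ℂ) ^ 2 * u.toFun x * φ x) (volume.restrict Ω) :=
    (u.memLp.const_mul _).integrable_mul hφm
  have i3 : Integrable (fun x => F x * φ x) (volume.restrict Ω) := hF.integrable_mul hφm
  have i1' : Integrable (fun x => -∑ i, u.grad i x * partialDeriv i φ x) (volume.restrict Ω) :=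
    i1.neg
  rw [integral_add i1' i2, integral_neg] at h
  simp_rw [sub_mul]
  rw [integral_sub i3 i2, ← h]
  ring

theorem HasWeakLaplacian.ae_eq_weakLaplacian {Ω : Set E3} (hΩ : IsOpen Ω) {u : SobolevH1 Ω}
    {f : E3 → ℂ} (h : HasWeakLaplacian u f) : weakLaplacian u =ᵐ[volume.restrict Ω] f := by
  have hex : ∃ f, HasWeakLaplacian u f := ⟨f, h⟩
  rw [weakLaplacian, dif_pos hex]
  exact hex.choose_spec.ae_eq hΩ h

/-- The boundary form of a weak solution and a solution of the Helmholtz equation. -/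
theorem boundaryForm_eq_integral {Ω : Set E3} (hΩ : IsBoundedC2Domain Ω) {k : ℝ} {D : Set E3}
    (hD : IsOpen D) (hDΩ : D ⊆ Ω) {ρ : E3 → ℂ} (hρ : MemLp ρ 2 (volume.restrict D))
    {u : SobolevH1 Ω} (hu : IsWeakSolution k (source ρ D) u) {g : E3 → ℂ} (hg : IsTrace u g)
    {w : E3 → ℂ} (hw : ContDiff ℝ 2 w) (hk : ∀ x, laplace w x = -(k : ℂ) ^ 2 * w x) :
    boundaryForm u g w = ∫ x in D, ρ x * w x := by
  have hF : MemLp (source ρ D) 2 (volume.restrict Ω) := memLp_source hD hρ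
  have hwm := hΩ.memLp_volume hw.continuous
  have hw1 : ∀ i, Continuous (partialDeriv i w) := fun i =>
    (contDiff_partialDeriv (m := 0) hw (by norm_num) i).continuous
  have hlap := (hu.hasWeakLaplacian hF).ae_eq_weakLaplacian hΩ.isOpen
  -- Replacing `Δu` by `F - k²u` and `-k²w` by `Δw` produces the terms of Green's formula, which
  -- cancel in the boundary form, and the source term.
  have e1 : normalDerivPairing u w = (∑ i, ∫ x in Ω, partialDeriv i w x * u.grad i x)
      + (∫ x in Ω, source ρ D x * w x) + ∫ x in Ω, laplace w x * u.toFun x := by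
    have i1 : ∀ i, Integrable (fun x => partialDeriv i w x * u.grad i x) (volume.restrict Ω) :=
      fun i => (hΩ.memLp_volume (hw1 i)).integrable_mul (u.memLp_grad i)
    have i2 : Integrable (fun x => source ρ D x * w x) (volume.restrict Ω) := hF.integrable_mul hwm
    have i3 : Integrable (fun x => laplace w x * u.toFun x) (volume.restrict Ω) :=
      (hΩ.memLp_volume (IsBoundedC2Domain.continuous_laplace hw)).integrable_mul u.memLp
    have i4 : Integrable (fun x => ∑ i, partialDeriv i w x * u.grad i x) (volume.restrict Ω) :=
      integrable_finsetSum _ fun i _ => i1 i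
    have i5 : Integrable (fun x => ∑ i, partialDeriv i w x * u.grad i x + source ρ D x * w x)
      (volume.restrict Ω) := i4.add i2
    rw [← integral_finsetSum _ fun i _ => i1 i, ← integral_add i4 i2, ← integral_add i5 i3,
      normalDerivPairing]
    refine integral_congr_ae ?_
    filter_upwards [hlap] with x hx
    rw [hx, hk]
    simp only [mul_comm (partialDeriv _ w x)]
    ring
  have e2 : ∫ x in Ω, source ρ D x * w x = ∫ x in D, ρ x * w x := by
    have : (fun x => source ρ D x * w x) = D.indicator fun x => ρ x * w x := by
      funext x
      by_cases hx : x ∈ D <;> simp [source, hx]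
    rw [this, setIntegral_indicator hD.measurableSet, Set.inter_eq_self_of_subset_right hDΩ]
  rw [boundaryForm, e1, hΩ.integral_normalDeriv_mul_trace hg hw, e2]
  ring

/-! ### The exponential solutions -/

/-- The complex-valued linear form `x ↦ ∑ zᵢ xᵢ`. -/
def complexForm (z : Fin 3 → ℂ) : E3 →L[ℝ] ℂ :=
  ∑ i, (EuclideanSpace.proj i : E3 →L[ℝ] ℝ).smulRight (z i)

theorem complexForm_apply (z : Fin 3 → ℂ) (x : E3) : complexForm z x = ∑ i, (x i : ℂ) * z i := by
  simp [complexForm]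

/-- Affine functions times a fixed exponential form a class stable under differentiation that
contains both `v` and `v_τ`. -/
theorem partialDeriv_complexForm_mul_exp (a z : Fin 3 → ℂ) (c : ℂ) (i : Fin 3) :
    partialDeriv i (fun x => (complexForm a x + c) * Complex.exp (complexForm z x))
      = fun x => (complexForm (z i • a) x + (z i * c + a i)) * Complex.exp (complexForm z x) := by
  funext x
  have h1 : HasFDerivAt (fun x => complexForm a x + c) (complexForm a) x :=
    (complexForm a).hasFDerivAt.add_const c
  have h2 : HasFDerivAt (fun x => Complex.exp (complexForm z x)) _ x :=
    (complexForm z).hasFDerivAt.cexp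
  have e : ∀ b : Fin 3 → ℂ, complexForm b (EuclideanSpace.single i 1) = b i := by
    intro b
    rw [complexForm_apply, Finset.sum_eq_single i] <;> simp +contextual
  have e2 : complexForm (z i • a) x = z i * complexForm a x := by
    simp only [complexForm_apply, Finset.mul_sum, Pi.smul_apply, smul_eq_mul]
    exact Finset.sum_congr rfl fun j _ => by ring
  have h3 : HasFDerivAt (fun x => (complexForm a x + c) * Complex.exp (complexForm z x)) _ x :=
    h1.mul h2
  rw [partialDeriv, h3.fderiv, e2]
  simp [e]
  ring

theorem contDiff_complexForm_mul_exp (a z : Fin 3 → ℂ) (c : ℂ) {n : WithTop ℕ∞} :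
    ContDiff ℝ n fun x => (complexForm a x + c) * Complex.exp (complexForm z x) :=
  ((complexForm a).contDiff.add contDiff_const).mul (complexForm z).contDiff.cexp

theorem laplace_complexForm_mul_exp (a z : Fin 3 → ℂ) (c : ℂ) (x : E3) :
    laplace (fun x => (complexForm a x + c) * Complex.exp (complexForm z x)) x
      = ((∑ i, z i ^ 2) * (complexForm a x + c) + 2 * ∑ i, a i * z i)
        * Complex.exp (complexForm z x) := by
  have e2 : ∀ s : ℂ, complexForm (s • a) x = s * complexForm a x := by
    intro s
    simp only [complexForm_apply, Finset.mul_sum, Pi.smul_apply, smul_eq_mul]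
    exact Finset.sum_congr rfl fun j _ => by ring
  simp only [laplace, partialDeriv_complexForm_mul_exp, smul_smul, e2, Pi.smul_apply, smul_eq_mul,
    Fin.sum_univ_three]
  ring

/-- `expSol` is the exponential of a complex-valued linear form. -/
theorem expSol_eq (k : ℝ) (ω ϑ : E3) (τ : ℝ) :
    expSol k ω ϑ τ = fun x => (complexForm 0 x + 1) * Complex.exp (complexForm
      (fun i => (τ : ℂ) * ω i + Complex.I * (√(τ ^ 2 + k ^ 2) : ℝ) * ϑ i) x) := by
  funext x
  simp only [expSol, complexForm_apply, PiLp.inner_apply, Fin.sum_univ_three]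
  simp
  congr 1
  ring

theorem expSolDeriv_eq (k : ℝ) (ω ϑ : E3) (τ : ℝ) :
    expSolDeriv k ω ϑ τ = fun x => (complexForm
      (fun i => (ω i : ℂ) + Complex.I * (τ / √(τ ^ 2 + k ^ 2) : ℝ) * ϑ i) x + 0)
        * Complex.exp (complexForm
      (fun i => (τ : ℂ) * ω i + Complex.I * (√(τ ^ 2 + k ^ 2) : ℝ) * ϑ i) x) := by
  funext x
  rw [expSolDeriv, expSol_eq]
  simp only [complexForm_apply, PiLp.inner_apply, Fin.sum_univ_three]
  simp
  ring

theorem sum_sq_of_unit {ω : E3} (hω : ‖ω‖ = 1) : (ω 0 : ℂ) ^ 2 + ω 1 ^ 2 + ω 2 ^ 2 = 1 := by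
  have h := EuclideanSpace.real_norm_sq_eq ω
  rw [hω, Fin.sum_univ_three] at h
  have h' : ω 0 ^ 2 + ω 1 ^ 2 + ω 2 ^ 2 = (1 : ℝ) := by linarith
  exact_mod_cast h'

theorem sum_mul_of_orthogonal {ω ϑ : E3} (h : ⟪ω, ϑ⟫ = 0) :
    (ω 0 : ℂ) * ϑ 0 + ω 1 * ϑ 1 + ω 2 * ϑ 2 = 0 := by
  rw [PiLp.inner_apply, Fin.sum_univ_three] at h
  simp only [RCLike.inner_apply, conj_trivial] at h
  have h' : ω 0 * ϑ 0 + ω 1 * ϑ 1 + ω 2 * ϑ 2 = (0 : ℝ) := by linarith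
  exact_mod_cast h'

/-- The frequency vector has complex square `τ² - (τ² + k²) = -k²`, because `ω` and `ϑ` are
orthonormal. -/
theorem laplace_expSol (k : ℝ) {ω ϑ : E3} (hω : ‖ω‖ = 1) (hϑ : ‖ϑ‖ = 1) (hωϑ : ⟪ω, ϑ⟫ = 0)
    (τ : ℝ) (x : E3) : laplace (expSol k ω ϑ τ) x = -(k : ℂ) ^ 2 * expSol k ω ϑ τ x := by
  have h1 := sum_sq_of_unit hω
  have h2 := sum_sq_of_unit hϑ
  have h3 := sum_mul_of_orthogonal hωϑ
  have hm : ((√(τ ^ 2 + k ^ 2) : ℝ) : ℂ) ^ 2 = (τ : ℂ) ^ 2 + (k : ℂ) ^ 2 := by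
    exact_mod_cast Real.sq_sqrt (by positivity : 0 ≤ τ ^ 2 + k ^ 2)
  rw [expSol_eq, laplace_complexForm_mul_exp, ← mul_assoc]
  congr 1
  simp only [Fin.sum_univ_three, Pi.zero_apply, zero_mul]
  generalize ((√(τ ^ 2 + k ^ 2) : ℝ) : ℂ) = m at hm
  generalize (complexForm 0) x = c
  linear_combination (c + 1) * (τ ^ 2 * h1 + Complex.I ^ 2 * m ^ 2 * h2 + 2 * τ * Complex.I * m * h3
    + Complex.I ^ 2 * hm + (τ ^ 2 + k ^ 2) * Complex.I_sq)

/-- The linear factor adds only a cross term, twice the product of the frequency vector with its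
`τ`-derivative. It is `τ - (τ/√(τ²+k²))√(τ²+k²) = 0`; `τ > 0` keeps the root from vanishing. -/
theorem laplace_expSolDeriv (k : ℝ) {ω ϑ : E3} (hω : ‖ω‖ = 1) (hϑ : ‖ϑ‖ = 1) (hωϑ : ⟪ω, ϑ⟫ = 0)
    {τ : ℝ} (hτ : 0 < τ) (x : E3) :
    laplace (expSolDeriv k ω ϑ τ) x = -(k : ℂ) ^ 2 * expSolDeriv k ω ϑ τ x := by
  have h1 := sum_sq_of_unit hω
  have h2 := sum_sq_of_unit hϑ
  have h3 := sum_mul_of_orthogonal hωϑ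
  have hm : ((√(τ ^ 2 + k ^ 2) : ℝ) : ℂ) ^ 2 = (τ : ℂ) ^ 2 + (k : ℂ) ^ 2 := by
    exact_mod_cast Real.sq_sqrt (by positivity : 0 ≤ τ ^ 2 + k ^ 2)
  have hmm : ((τ / √(τ ^ 2 + k ^ 2) : ℝ) : ℂ) * ((√(τ ^ 2 + k ^ 2) : ℝ) : ℂ) = τ := by
    rw [← Complex.ofReal_mul, div_mul_cancel₀ _ (by positivity)]
  rw [expSolDeriv_eq, laplace_complexForm_mul_exp, ← mul_assoc]
  congr 1
  simp only [Fin.sum_univ_three]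
  generalize ((τ / √(τ ^ 2 + k ^ 2) : ℝ) : ℂ) = n at hmm
  generalize ((√(τ ^ 2 + k ^ 2) : ℝ) : ℂ) = m at hm hmm
  generalize (complexForm (fun i => (ω i : ℂ) + Complex.I * n * ϑ i)) x = c
  linear_combination c * (τ ^ 2 * h1 + Complex.I ^ 2 * m ^ 2 * h2 + 2 * τ * Complex.I * m * h3
    + Complex.I ^ 2 * hm + (τ ^ 2 + k ^ 2) * Complex.I_sq)
    + 2 * (τ * h1 + Complex.I ^ 2 * n * m * h2 + Complex.I * (m + n * τ) * h3
      + Complex.I ^ 2 * hmm + τ * Complex.I_sq)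

theorem contDiff_expSol (k : ℝ) (ω ϑ : E3) (τ : ℝ) {n : WithTop ℕ∞} :
    ContDiff ℝ n (expSol k ω ϑ τ) := by
  rw [expSol_eq]; exact contDiff_complexForm_mul_exp _ _ _

theorem contDiff_expSolDeriv (k : ℝ) (ω ϑ : E3) (τ : ℝ) {n : WithTop ℕ∞} :
    ContDiff ℝ n (expSolDeriv k ω ϑ τ) := by
  rw [expSolDeriv_eq]; exact contDiff_complexForm_mul_exp _ _ _

/-! ### The Laplace integral over an infinite cone -/

theorem integrableOn_sq_mul_exp_neg : IntegrableOn (fun t : ℝ => t ^ 2 * Real.exp (-t))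
    (Set.Ioi 0) := by
  have h := Real.GammaIntegral_convergent (s := 3) (by norm_num)
  refine h.congr_fun (fun t _ => ?_) measurableSet_Ioi
  simp only
  rw [mul_comm, show (3 : ℝ) - 1 = (2 : ℕ) by norm_num, Real.rpow_natCast]

theorem norm_exp_neg_one_sub_mul (β t : ℝ) :
    ‖Complex.exp (-((1 - Complex.I * β) * t))‖ = Real.exp (-t) := by
  rw [Complex.norm_exp]
  simp

theorem integrableOn_sq_mul_cexp (β : ℝ) : IntegrableOn
    (fun t : ℝ => (t : ℂ) ^ 2 * Complex.exp (-((1 - Complex.I * β) * t))) (Set.Ioi 0) := by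
  refine integrableOn_sq_mul_exp_neg.mono' (by fun_prop) (Eventually.of_forall fun t => ?_)
  rw [norm_mul, norm_exp_neg_one_sub_mul, norm_pow, Complex.norm_real, Real.norm_eq_abs, sq_abs]

theorem one_sub_I_mul_ne_zero (β : ℝ) : (1 - Complex.I * β : ℂ) ≠ 0 := by
  intro h
  have := congrArg Complex.re h
  simp at this

theorem integral_sq_mul_cexp (β : ℝ) :
    ∫ t in Set.Ioi (0 : ℝ), (t : ℂ) ^ 2 * Complex.exp (-((1 - Complex.I * β) * t))
      = 2 / (1 - Complex.I * β) ^ 3 := by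
  set c : ℂ := 1 - Complex.I * β with hc
  have hc0 : c ≠ 0 := one_sub_I_mul_ne_zero β
  -- `P t * exp (-(c t))` is the antiderivative obtained from two integrations by parts.
  set P : ℝ → ℂ := fun t => -((t : ℂ) ^ 2 / c + 2 * t / c ^ 2 + 2 / c ^ 3) with hP
  have hder : ∀ t ∈ Set.Ici (0 : ℝ), HasDerivAt (fun t : ℝ => P t * Complex.exp (-(c * t)))
      ((t : ℂ) ^ 2 * Complex.exp (-(c * t))) t := by
    intro t _
    have h1 : HasDerivAt (fun t : ℝ => (t : ℂ)) 1 t := Complex.ofRealCLM.hasDerivAt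
    have h2 := (h1.const_mul c).neg.cexp
    have h3 := ((((h1.pow 2).div_const c).add ((h1.const_mul 2).div_const (c ^ 2))).add_const
      (2 / c ^ 3)).neg
    refine (h3.mul h2).congr_deriv ?_
    simp
    field_simp
    ring
  have hlim : Tendsto (fun t : ℝ => P t * Complex.exp (-(c * t))) atTop (𝓝 0) := by
    have hn : ∀ n : ℕ, Tendsto (fun t : ℝ => (t : ℂ) ^ n * Complex.exp (-(c * t))) atTop (𝓝 0) := by
      intro n
      rw [tendsto_zero_iff_norm_tendsto_zero]
      refine (Real.tendsto_pow_mul_exp_neg_atTop_nhds_zero n).congr' ?_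
      filter_upwards [eventually_ge_atTop 0] with t ht
      rw [norm_mul, norm_exp_neg_one_sub_mul, norm_pow, Complex.norm_real, Real.norm_eq_abs,
        abs_of_nonneg ht]
    have h := (((hn 2).mul_const (1 / c)).add ((hn 1).mul_const (2 / c ^ 2))).add
      ((hn 0).mul_const (2 / c ^ 3))
    have h' := h.neg
    simp only [zero_mul, add_zero, neg_zero] at h'
    refine h'.congr fun t => ?_
    simp only [hP]
    ring
  rw [integral_Ioi_of_hasDerivAt_of_tendsto' hder (integrableOn_sq_mul_cexp β) hlim]
  simp [hP]

/-- The infinite cone generated by `Q - p`. -/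
def infCone (p ω : E3) (δ : ℝ) (Q : Set E3) : Set E3 :=
  {y | ⟪y, ω⟫ < 0 ∧ p + (δ / -⟪y, ω⟫) • y ∈ Q}

namespace IsConeBase

variable {p ω : E3} {δ : ℝ} {Q : Set E3}

theorem inner_eq (hQ : IsConeBase p ω δ Q) {z : E3} (hz : z ∈ Q) : ⟪z, ω⟫ = ⟪p, ω⟫ - δ := by
  obtain ⟨U, -, rfl⟩ := hQ.relOpen
  exact hz.2

theorem measurableSet (hQ : IsConeBase p ω δ Q) : MeasurableSet Q := by
  obtain ⟨U, hU, rfl⟩ := hQ.relOpen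
  exact hU.measurableSet.inter (measurableSet_eq_fun (by fun_prop) (by fun_prop))

theorem measurableSet_infCone (hQ : IsConeBase p ω δ Q) : MeasurableSet (infCone p ω δ Q) := by
  have h0 : MeasurableSet {y : E3 | ⟪y, ω⟫ < 0} := measurableSet_lt (by fun_prop) (by fun_prop)
  refine h0.inter ?_
  have : Measurable fun y : E3 => p + (δ / -⟪y, ω⟫) • y := by fun_prop
  exact this hQ.measurableSet

theorem exists_norm_le (hQ : IsConeBase p ω δ Q) : ∃ R > 0, ∀ z ∈ Q, ‖z - p‖ ≤ R := by
  obtain ⟨R, hR⟩ := hQ.bounded.exists_norm_le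
  refine ⟨|R| + ‖p‖ + 1, by positivity, fun z hz => ?_⟩
  have h1 := norm_sub_le z p
  have h2 := hR z hz
  have h3 := le_abs_self R
  linarith

/-- Bounded `Q` means that depth below the apex controls distance from it. Hence `exp (y·ω)` decays
exponentially in the cone, and points of small depth are close to `p`. -/
theorem exists_mul_norm_le (hQ : IsConeBase p ω δ Q) (hδ : 0 < δ) :
    ∃ c > 0, ∀ y ∈ infCone p ω δ Q, c * ‖y‖ ≤ -⟪y, ω⟫ := by
  obtain ⟨R, hR, hz⟩ := hQ.exists_norm_le
  refine ⟨δ / R, by positivity, fun y hy => ?_⟩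
  have h := hz _ hy.2
  have hpos : 0 < -⟪y, ω⟫ := neg_pos.2 hy.1
  rw [add_sub_cancel_left, norm_smul, Real.norm_eq_abs, abs_of_pos (by positivity),
    div_mul_eq_mul_div, div_le_iff₀ hpos] at h
  rw [div_mul_eq_mul_div, div_le_iff₀ hR]
  linarith

theorem mem_cone_iff (hQ : IsConeBase p ω δ Q) (hδ : 0 < δ) (x : E3) :
    x ∈ cone p δ Q ↔ x - p ∈ infCone p ω δ Q ∧ -⟪x - p, ω⟫ < δ := by
  constructor
  · rintro ⟨s, hs, hsδ, z, hz, rfl⟩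
    have h1 : ⟪p + (s / δ) • (z - p) - p, ω⟫ = -s := by
      rw [add_sub_cancel_left, real_inner_smul_left, inner_sub_left, hQ.inner_eq hz]
      field_simp
      ring
    refine ⟨⟨by rw [h1]; linarith, ?_⟩, by rw [h1]; linarith⟩
    rw [h1, add_sub_cancel_left, smul_smul]
    have : δ / - -s * (s / δ) = 1 := by field_simp
    rw [this, one_smul, add_sub_cancel]
    exact hz
  · rintro ⟨⟨h1, h2⟩, h3⟩
    refine ⟨-⟪x - p, ω⟫, by linarith, h3, _, h2, ?_⟩
    have hne : -⟪x - p, ω⟫ ≠ 0 := by linarith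
    rw [add_sub_cancel_left, smul_smul, div_mul_div_cancel₀ hδ.ne', div_self hne, one_smul,
      add_sub_cancel]

end IsConeBase

/-- Scale invariance is what makes the blow-up at the apex converge. -/
theorem smul_mem_infCone_iff {p ω : E3} {δ : ℝ} {Q : Set E3} {r : ℝ} (hr : 0 < r) (y : E3) :
    r • y ∈ infCone p ω δ Q ↔ y ∈ infCone p ω δ Q := by
  simp only [infCone, Set.mem_ofPred_eq, real_inner_smul_left, smul_smul]
  have h1 : r * ⟪y, ω⟫ < 0 ↔ ⟪y, ω⟫ < 0 := by
    constructor <;> intro h <;> nlinarith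
  rw [h1]
  refine and_congr_right fun h => ?_
  have : δ / -(r * ⟪y, ω⟫) * r = δ / -⟪y, ω⟫ := by
    field_simp
  rw [this]

theorem integrable_exp_neg_mul_norm {c : ℝ} (hc : 0 < c) :
    Integrable fun y : E3 => Real.exp (-(c * ‖y‖)) := by
  -- With this `a` one has `a (1 + r) ≤ exp (c r / 4)`. The fourth power compares the exponential
  -- with `(1 + r)⁻⁴`, integrable in dimension three.
  set a := min (c / 4) 1 with ha
  have ha0 : 0 < a := by positivity
  have h := (integrable_one_add_norm (E := E3) (μ := volume) (r := (4 : ℕ))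
    (by rw [finrank_euclideanSpace_fin]; norm_num)).const_mul ((1 / a) ^ 4)
  refine h.mono' (by fun_prop) (Eventually.of_forall fun y => ?_)
  rw [Real.norm_eq_abs, abs_of_pos (Real.exp_pos _), Real.rpow_neg (by positivity),
    Real.rpow_natCast, Real.exp_neg, div_pow, one_pow, one_div, ← mul_inv]
  refine inv_anti₀ (by positivity) ?_
  have h1 : a * (1 + ‖y‖) ≤ Real.exp (c / 4 * ‖y‖) := by
    have h2 := Real.add_one_le_exp (c / 4 * ‖y‖)
    have h3 : a ≤ c / 4 := min_le_left _ _
    have h4 : a ≤ 1 := min_le_right _ _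
    nlinarith [norm_nonneg y]
  calc a ^ 4 * (1 + ‖y‖) ^ 4 = (a * (1 + ‖y‖)) ^ 4 := by ring
    _ ≤ Real.exp (c / 4 * ‖y‖) ^ 4 := by gcongr
    _ = Real.exp (c * ‖y‖) := by rw [← Real.exp_nat_mul]; congr 1; push_cast; ring

theorem IsConeBase.integrable_infCone {p ω : E3} {δ : ℝ} {Q : Set E3} (hQ : IsConeBase p ω δ Q)
    (hδ : 0 < δ) : IntegrableOn (fun y : E3 => Real.exp ⟪y, ω⟫) (infCone p ω δ Q) := by
  obtain ⟨c, hc, h⟩ := hQ.exists_mul_norm_le hδ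
  refine ((integrable_exp_neg_mul_norm hc).integrableOn).mono' (by fun_prop) ?_
  filter_upwards [ae_restrict_mem hQ.measurableSet_infCone] with y hy
  rw [Real.norm_eq_abs, abs_of_pos (Real.exp_pos _)]
  exact Real.exp_le_exp.2 (by linarith [h y hy])

/-- The reflection exchanging two unit vectors. It makes the third coordinate the depth below the
apex. -/
theorem exists_isometry_map_neg {ω : E3} (hω : ‖ω‖ = 1) :
    ∃ e : E3 ≃ₗᵢ[ℝ] E3, e (-ω) = join3 0 1 := by
  refine ⟨_, Submodule.reflection_sub ?_⟩
  rw [norm_neg, hω, EuclideanSpace.norm_eq]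
  simp [join3, Fin.sum_univ_three]

/-! ### Coordinates along the axis of the cone -/

section Frame

variable {p ω ϑ : E3} {δ : ℝ} {Q : Set E3} {e : E3 ≃ₗᵢ[ℝ] E3}

theorem inner_symm_join3 (he : e (-ω) = join3 0 1) (x : E2) (t : ℝ) :
    ⟪e.symm (join3 x t), ω⟫ = -t := by
  have h : ⟪e.symm (join3 x t), -ω⟫ = t := by
    rw [← e.inner_map_map, e.apply_symm_apply, he]
    simp [join3, PiLp.inner_apply, Fin.sum_univ_three]
  rw [inner_neg_right] at h
  linarith

theorem inner_symm_join3' (he : e (-ω) = join3 0 1) (hωϑ : ⟪ω, ϑ⟫ = 0) (x : E2) (t : ℝ) :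
    ⟪e.symm (join3 x t), ϑ⟫ = ⟪x, proj2 (e ϑ)⟫ := by
  have h2 : e ϑ 2 = 0 := by
    have h : ⟪e (-ω), e ϑ⟫ = 0 := by rw [e.inner_map_map, inner_neg_left, hωϑ, neg_zero]
    rw [he] at h
    simpa [join3, PiLp.inner_apply, Fin.sum_univ_three] using h
  rw [← e.inner_map_map, e.apply_symm_apply]
  simp [join3, proj2, PiLp.inner_apply, Fin.sum_univ_three, h2]

/-- The base of the cone in the coordinates given by `e`, scaled to height one. -/
def unitBase (p : E3) (δ : ℝ) (Q : Set E3) (e : E3 ≃ₗᵢ[ℝ] E3) : Set E2 :=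
  {b | p + δ • e.symm (join3 b 1) ∈ Q}

theorem smul_join3 (c : ℝ) (x : E2) (t : ℝ) : c • join3 x t = join3 (c • x) (c * t) := by
  ext i; fin_cases i <;> simp [join3]

theorem symm_join3_mem_infCone_iff (he : e (-ω) = join3 0 1) (x : E2) (t : ℝ) :
    e.symm (join3 x t) ∈ infCone p ω δ Q ↔ 0 < t ∧ t⁻¹ • x ∈ unitBase p δ Q e := by
  simp only [infCone, Set.mem_ofPred_eq, inner_symm_join3 he, unitBase, neg_neg, neg_lt_zero]
  refine and_congr_right fun ht => ?_
  have : δ • e.symm (join3 (t⁻¹ • x) 1) = (δ / t) • e.symm (join3 x t) := by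
    rw [div_eq_mul_inv, mul_smul, ← map_smul e.symm t⁻¹, smul_join3, inv_mul_cancel₀ ht.ne']
  rw [this]

theorem measurable_join3 (t : ℝ) : Measurable fun b : E2 => join3 b t :=
  ((contDiff_join3 (n := 0)).continuous.comp (by fun_prop : Continuous fun b : E2 => (b, t)))
    |>.measurable

theorem measurableSet_unitBase (hQ : IsConeBase p ω δ Q) : MeasurableSet (unitBase p δ Q e) := by
  have : Measurable fun b : E2 => p + δ • e.symm (join3 b 1) :=
    ((e.symm.continuous.measurable.comp (measurable_join3 1)).const_smul δ).const_add p
  exact this hQ.measurableSet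

theorem norm_le_norm_join3 (b : E2) (t : ℝ) : ‖b‖ ≤ ‖join3 b t‖ := by
  rw [EuclideanSpace.norm_eq, EuclideanSpace.norm_eq]
  refine Real.sqrt_le_sqrt ?_
  simp [join3, Fin.sum_univ_three]
  positivity

theorem isBounded_unitBase (hQ : IsConeBase p ω δ Q) (hδ : 0 < δ) :
    Bornology.IsBounded (unitBase p δ Q e) := by
  obtain ⟨R, hR, hz⟩ := hQ.exists_norm_le
  refine isBounded_iff_forall_norm_le.2 ⟨R / δ, fun b hb => ?_⟩
  have h := hz _ hb
  rw [add_sub_cancel_left, norm_smul, Real.norm_eq_abs, abs_of_pos hδ, e.symm.norm_map] at h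
  rw [le_div_iff₀ hδ]
  nlinarith [norm_le_norm_join3 b 1]

/-- The slice at depth `t` is `t` times the unit base. The substitution `x = t b` gives a factor
`t²` and the exponent `-(1 - iβ)t` with `β = ⟪b, a⟫`. After exchanging the integrals, the one over
`t` is `integral_sq_mul_cexp`. -/
theorem integral_infCone_eq (he : e (-ω) = join3 0 1) (hωϑ : ⟪ω, ϑ⟫ = 0) (hδ : 0 < δ)
    (hQ : IsConeBase p ω δ Q) :
    ∫ y in infCone p ω δ Q, Complex.exp ((⟪y, ω⟫ : ℝ) + Complex.I * (⟪y, ϑ⟫ : ℝ))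
      = ∫ b in unitBase p δ Q e, 2 / (1 - Complex.I * (⟪b, proj2 (e ϑ)⟫ : ℝ)) ^ 3 := by
  set a := proj2 (e ϑ) with ha
  set B := unitBase p δ Q e with hB
  have hBm : MeasurableSet B := measurableSet_unitBase hQ
  set T : E2 × ℝ ≃ₜ E3 := (graphShear (γ := fun _ => 0) continuous_const).trans
    e.symm.toHomeomorph with hT
  have hTe : ∀ q, T q = e.symm (join3 q.1 q.2) := by
    intro q
    change e.symm (join3 q.1 (0 + q.2)) = _
    rw [zero_add]
  have hTp : MeasurePreserving T :=
    e.symm.measurePreserving.comp (measurePreserving_graphShear continuous_const)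
  set f : E3 → ℂ := fun y => Complex.exp ((⟪y, ω⟫ : ℝ) + Complex.I * (⟪y, ϑ⟫ : ℝ)) with hf
  have hfi : IntegrableOn f (infCone p ω δ Q) := by
    refine (hQ.integrable_infCone hδ).mono' (by fun_prop) (Eventually.of_forall fun y => ?_)
    rw [hf, Complex.norm_exp]
    simp
  set S := T ⁻¹' (infCone p ω δ Q) with hS
  have hSm : MeasurableSet S := T.measurable hQ.measurableSet_infCone
  have e1 : ∫ y in infCone p ω δ Q, f y = ∫ q in S, f (T q) :=
    (hTp.setIntegral_preimage_emb T.measurableEmbedding f _).symm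
  have hi : Integrable (S.indicator fun q => f (T q)) (volume.prod volume) := by
    rw [integrable_indicator_iff hSm, ← Measure.volume_eq_prod]
    exact (hTp.integrableOn_comp_preimage T.measurableEmbedding).2 hfi
  rw [e1, ← integral_indicator hSm, Measure.volume_eq_prod, integral_prod_symm _ hi]
  have hind : ∀ x t, S.indicator (fun q => f (T q)) (x, t)
      = (Set.Ioi (0 : ℝ)).indicator (fun t => B.indicator
        (fun b => Complex.exp (-((1 - Complex.I * (⟪b, a⟫ : ℝ)) * t))) (t⁻¹ • x)) t := by
    intro x t
    have hiff : (x, t) ∈ S ↔ 0 < t ∧ t⁻¹ • x ∈ B := by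
      rw [hS, Set.mem_preimage, hTe]
      exact symm_join3_mem_infCone_iff he x t
    by_cases ht : 0 < t
    · rw [Set.indicator_of_mem (show t ∈ Set.Ioi (0 : ℝ) from ht)]
      by_cases hx : t⁻¹ • x ∈ B
      · rw [Set.indicator_of_mem (hiff.2 ⟨ht, hx⟩), Set.indicator_of_mem hx, hTe]
        simp only [hf]
        rw [inner_symm_join3 he, inner_symm_join3' he hωϑ, real_inner_smul_left]
        congr 1
        push_cast
        have : (t : ℂ) ≠ 0 := by exact_mod_cast ht.ne'
        field_simp
        ring
      · rw [Set.indicator_of_notMem (fun h => hx (hiff.1 h).2), Set.indicator_of_notMem hx]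
    · rw [Set.indicator_of_notMem (fun h => ht (hiff.1 h).1), Set.indicator_of_notMem (show t ∉ Set.Ioi (0 : ℝ) from ht)]
  have hslice : ∀ t, ∫ x, S.indicator (fun q => f (T q)) (x, t)
      = (Set.Ioi (0 : ℝ)).indicator (fun t => ∫ b in B,
        (t : ℂ) ^ 2 * Complex.exp (-((1 - Complex.I * (⟪b, a⟫ : ℝ)) * t))) t := by
    intro t
    simp_rw [hind]
    by_cases ht : 0 < t
    · simp only [Set.indicator_of_mem (show t ∈ Set.Ioi (0 : ℝ) from ht)]
      rw [Measure.integral_comp_smul volume (B.indicator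
        fun b => Complex.exp (-((1 - Complex.I * (⟪b, a⟫ : ℝ)) * t))) t⁻¹, integral_indicator hBm,
        integral_const_mul, finrank_euclideanSpace_fin, abs_of_pos (by positivity),
        Complex.real_smul]
      congr 1
      push_cast
      simp
    · simp [Set.indicator_of_notMem (show t ∉ Set.Ioi (0 : ℝ) from ht)]
  simp_rw [hslice]
  rw [integral_indicator measurableSet_Ioi, integral_integral_swap]
  · exact integral_congr_ae (Eventually.of_forall fun b => integral_sq_mul_cexp _)
  -- Exchanging the integrals is allowed because `t² exp (-t)` dominates and the base has finite
  -- area.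
  · have hBf : IntegrableOn (fun _ : E2 => (1 : ℝ)) B :=
      integrableOn_const (isBounded_unitBase hQ hδ).measure_lt_top.ne
    have hp := integrableOn_sq_mul_exp_neg.integrable.mul_prod hBf.integrable
    refine hp.mono' (by fun_prop) (Eventually.of_forall fun q => ?_)
    simp only [Function.uncurry]
    rw [norm_mul, norm_exp_neg_one_sub_mul, norm_pow, Complex.norm_real, Real.norm_eq_abs, sq_abs,
      mul_one]

/-- The section at depth `s` is an isometric copy of `s` times the unit base. Rescaling gives `s²`
from area and `s⁻³` from the integrand, which cancel the prefactor `s`; hence the independence of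
`s`. -/
theorem coneConstant_eq_integral (he : e (-ω) = join3 0 1) (hωϑ : ⟪ω, ϑ⟫ = 0) (hδ : 0 < δ)
    (hQ : IsConeBase p ω δ Q) {s : ℝ} (hs : 0 < s) (hsδ : s < δ) :
    coneConstant p ω δ Q ϑ s
      = ∫ b in unitBase p δ Q e, 2 / (1 - Complex.I * (⟪b, proj2 (e ϑ)⟫ : ℝ)) ^ 3 := by
  set a := proj2 (e ϑ) with ha
  set B := unitBase p δ Q e with hB
  have hBm : MeasurableSet B := measurableSet_unitBase hQ
  set i : E2 → E3 := fun x => p + e.symm (join3 x s) with hi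
  have hiso : Isometry i := by
    refine (IsometryEquiv.addLeft p).isometry.comp (e.symm.isometry.comp ?_)
    refine Isometry.of_dist_eq fun x y => ?_
    rw [EuclideanSpace.dist_eq, EuclideanSpace.dist_eq]
    simp [join3, Fin.sum_univ_three]
  have hemb : MeasurableEmbedding i := hiso.isClosedEmbedding.measurableEmbedding
  have hsec : coneSection p ω δ Q s = i '' {x | s⁻¹ • x ∈ B} := by
    ext y
    constructor
    · rintro ⟨hy, hys⟩
      have hy1 := ((hQ.mem_cone_iff hδ y).1 hy).1
      have hyw : y - p = e.symm (join3 (proj2 (e (y - p))) s) := by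
        rw [LinearIsometryEquiv.eq_symm_apply]
        have h2 : e (y - p) 2 = s := by
          have h3 : ⟪e (y - p), e (-ω)⟫ = s := by
            have hys' : ⟪y, ω⟫ = ⟪p, ω⟫ - s := hys
            rw [e.inner_map_map, inner_neg_right, inner_sub_left, hys']
            ring
          rw [he] at h3
          simpa [join3, PiLp.inner_apply, Fin.sum_univ_three] using h3
        ext j; fin_cases j <;> simp [join3, proj2]
        simpa using h2
      refine ⟨proj2 (e (y - p)), ?_, ?_⟩
      · rw [hyw] at hy1
        exact ((symm_join3_mem_infCone_iff he _ _).1 hy1).2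
      · simp only [hi]
        rw [← hyw, add_sub_cancel]
    · rintro ⟨x, hx, rfl⟩
      have h1 : ⟪e.symm (join3 x s), ω⟫ = -s := inner_symm_join3 he x s
      refine ⟨(hQ.mem_cone_iff hδ _).2 ?_, ?_⟩
      · simp only [hi, add_sub_cancel_left]
        exact ⟨(symm_join3_mem_infCone_iff he x s).2 ⟨hs, hx⟩, by rw [h1]; linarith⟩
      · simp only [hi, Set.mem_ofPred_eq, inner_add_left, h1]
        ring
  set B' : Set E2 := {x | s⁻¹ • x ∈ B} with hB'
  have hB'm : MeasurableSet B' := by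
    have : Measurable fun x : E2 => s⁻¹ • x := by fun_prop
    exact this hBm
  have hmeas : surfaceMeasure (coneSection p ω δ Q s) = (volume.restrict B').map i := by
    rw [hsec, surfaceMeasure, ← EuclideanSpace.euclideanHausdorffMeasure_eq_volume 2]
    have h1 := hiso.map_euclideanHausdorffMeasure (d := 2)
    have h2 : i '' B' ⊆ Set.range i := Set.image_subset_range _ _
    rw [← Measure.restrict_restrict_of_subset h2, ← h1,
      hemb.restrict_map, hiso.injective.preimage_image]
  rw [coneConstant, hmeas, hemb.integral_map]
  have hpt : ∀ x : E2, B'.indicator (fun x => 1 / ((s : ℂ) - Complex.I * (⟪i x - p, ϑ⟫ : ℝ)) ^ 3) x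
      = B.indicator (fun b => (1 / (s : ℂ) ^ 3) * (1 / (1 - Complex.I * (⟪b, a⟫ : ℝ)) ^ 3))
        (s⁻¹ • x) := by
    intro x
    by_cases hx : x ∈ B'
    · rw [Set.indicator_of_mem hx, Set.indicator_of_mem (show s⁻¹ • x ∈ B from hx)]
      simp only [hi, add_sub_cancel_left]
      rw [inner_symm_join3' he hωϑ, real_inner_smul_left, one_div_mul_one_div, ← mul_pow]
      congr 2
      have : (s : ℂ) ≠ 0 := by exact_mod_cast hs.ne'
      push_cast
      field_simp
      rfl
    · rw [Set.indicator_of_notMem hx, Set.indicator_of_notMem (show s⁻¹ • x ∉ B from hx)]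
  rw [← integral_indicator hB'm]
  simp_rw [hpt]
  rw [Measure.integral_comp_smul volume (B.indicator fun b => (1 / (s : ℂ) ^ 3) *
    (1 / (1 - Complex.I * (⟪b, a⟫ : ℝ)) ^ 3)) s⁻¹, integral_indicator hBm, integral_const_mul,
    finrank_euclideanSpace_fin, abs_of_pos (by positivity), Complex.real_smul]
  simp_rw [div_eq_mul_one_div (2 : ℂ)]
  rw [integral_const_mul]
  have : (s : ℂ) ≠ 0 := by exact_mod_cast hs.ne'
  push_cast
  field_simp

end Frame

theorem integral_infCone_eq_coneConstant {p ω ϑ : E3} {δ : ℝ} {Q : Set E3} (hω : ‖ω‖ = 1)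
    (hωϑ : ⟪ω, ϑ⟫ = 0) (hδ : 0 < δ) (hQ : IsConeBase p ω δ Q) {s : ℝ} (hs : 0 < s) (hsδ : s < δ) :
    ∫ y in infCone p ω δ Q, Complex.exp ((⟪y, ω⟫ : ℝ) + Complex.I * (⟪y, ϑ⟫ : ℝ))
      = coneConstant p ω δ Q ϑ s := by
  obtain ⟨e, he⟩ := exists_isometry_map_neg hω
  rw [integral_infCone_eq he hωϑ hδ hQ, coneConstant_eq_integral he hωϑ hδ hQ hs hsδ]

/-! ### Asymptotics of the volume integrals -/

theorem tendsto_pow_mul_exp_neg_mul {δ : ℝ} (hδ : 0 < δ) (n : ℕ) :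
    Tendsto (fun τ : ℝ => τ ^ n * Real.exp (-(τ * δ))) atTop (𝓝 0) := by
  have h := ((Real.tendsto_pow_mul_exp_neg_atTop_nhds_zero n).comp
    (tendsto_id.atTop_mul_const hδ)).const_mul ((δ ^ n)⁻¹)
  rw [mul_zero] at h
  refine h.congr fun τ => ?_
  simp only [Function.comp_apply, id]
  rw [mul_pow]
  field_simp

theorem tendsto_add_inv_smul (p y : E3) :
    Tendsto (fun τ : ℝ => p + τ⁻¹ • y) atTop (𝓝 p) := by
  have h : Tendsto (fun τ : ℝ => p + τ⁻¹ • y) atTop (𝓝 (p + (0 : ℝ) • y)) :=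
    (tendsto_inv_atTop_zero.smul_const y).const_add p
  rwa [zero_smul, add_zero] at h

theorem tendsto_sqrt_div (k : ℝ) : Tendsto (fun τ : ℝ => √(τ ^ 2 + k ^ 2) / τ) atTop (𝓝 1) := by
  have h1 : Tendsto (fun τ : ℝ => √(1 + (k / τ) ^ 2)) atTop (𝓝 1) := by
    have h2 : Tendsto (fun τ : ℝ => k / τ) atTop (𝓝 0) := tendsto_const_nhds.div_atTop tendsto_id
    have h3 : Tendsto (fun τ : ℝ => 1 + (k / τ) ^ 2) atTop (𝓝 1) := by
      simpa using (h2.pow 2).const_add 1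
    simpa using h3.sqrt
  refine h1.congr' ?_
  filter_upwards [eventually_gt_atTop 0] with τ hτ
  rw [eq_div_iff hτ.ne', ← Real.sqrt_sq hτ.le, ← Real.sqrt_mul (by positivity), Real.sqrt_sq hτ.le]
  congr 1
  field_simp

theorem tendsto_div_sqrt (k : ℝ) : Tendsto (fun τ : ℝ => τ / √(τ ^ 2 + k ^ 2)) atTop (𝓝 1) := by
  have h := (tendsto_sqrt_div k).inv₀ one_ne_zero
  simpa using h

theorem expSol_add_smul (k : ℝ) (ω ϑ p y : E3) {τ : ℝ} (hτ : τ ≠ 0) :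
    expSol k ω ϑ τ (p + τ⁻¹ • y)
      = Complex.exp ((τ : ℂ) * (⟪p, ω⟫ : ℝ) + Complex.I * (√(τ ^ 2 + k ^ 2) : ℝ) * (⟪p, ϑ⟫ : ℝ))
        * Complex.exp ((⟪y, ω⟫ : ℝ)
          + Complex.I * (√(τ ^ 2 + k ^ 2) / τ : ℝ) * (⟪y, ϑ⟫ : ℝ)) := by
  rw [expSol, ← Complex.exp_add]
  congr 1
  simp only [inner_add_left, real_inner_smul_left]
  have : (τ : ℂ) ≠ 0 := by exact_mod_cast hτ
  push_cast
  field_simp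
  ring

theorem norm_expSol (k : ℝ) (ω ϑ : E3) (τ : ℝ) (x : E3) :
    ‖expSol k ω ϑ τ x‖ = Real.exp (τ * ⟪x, ω⟫) := by
  rw [expSol, Complex.norm_exp]
  simp

/-! ### Support function and the cone near its apex -/

section Support

variable {D : Set E3} {ω p : E3}

theorem IsRegularAt.supportFn_eq (hp : IsRegularAt D ω p) : supportFn D ω = ⟪p, ω⟫ := by
  have h : p ∈ supportFace D ω := by rw [hp]; rfl
  exact h.2.symm

theorem le_supportFn (hDb : Bornology.IsBounded D) {x : E3} (hx : x ∈ D) :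
    ⟪x, ω⟫ ≤ supportFn D ω := by
  refine le_csSup ?_ (Set.mem_image_of_mem _ hx)
  obtain ⟨R, hR⟩ := hDb.exists_norm_le
  refine ⟨R * ‖ω‖, ?_⟩
  rintro _ ⟨y, hy, rfl⟩
  exact (real_inner_le_norm y ω).trans (by gcongr; exact hR y hy)

/-- In an open set one can move a little further in the direction `ω`. So the strict upper bound in
the definition of the conical singularity holds automatically on `D`. -/
theorem lt_supportFn (hω : ‖ω‖ = 1) (hD : IsOpen D) (hDb : Bornology.IsBounded D) {x : E3}
    (hx : x ∈ D) : ⟪x, ω⟫ < supportFn D ω := by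
  obtain ⟨r, hr, hball⟩ := Metric.isOpen_iff.1 hD x hx
  have hmem : x + (r / 2) • ω ∈ D := by
    refine hball ?_
    rw [mem_ball, dist_eq_norm, add_sub_cancel_left, norm_smul, hω, Real.norm_eq_abs,
      abs_of_pos (by positivity)]
    linarith
  have h := le_supportFn (ω := ω) hDb hmem
  rw [inner_add_left, real_inner_smul_left, real_inner_self_eq_norm_sq, hω] at h
  linarith

end Support

theorem HasConicalSingularity.mem_iff {D : Set E3} {ω p : E3} {δ : ℝ} {Q : Set E3} (hω : ‖ω‖ = 1)
    (hD : IsOpen D) (hDb : Bornology.IsBounded D) (hp : IsRegularAt D ω p)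
    (hQ : HasConicalSingularity D ω p δ Q) {δ' : ℝ} (hδ' : δ' ≤ δ) (x : E3) :
    (x ∈ D ∧ ⟪p, ω⟫ - δ' < ⟪x, ω⟫) ↔ x - p ∈ infCone p ω δ Q ∧ -⟪x - p, ω⟫ < δ' := by
  have h1 := Set.ext_iff.1 hQ.eq_cone x
  rw [hQ.base.mem_cone_iff hQ.pos, hp.supportFn_eq] at h1
  rw [inner_sub_left] at h1 ⊢
  constructor
  · rintro ⟨hxD, hlt⟩
    have h2 := lt_supportFn hω hD hDb hxD
    rw [hp.supportFn_eq] at h2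
    exact ⟨(h1.1 ⟨hxD, by linarith, h2⟩).1, by linarith⟩
  · rintro ⟨hc, hlt⟩
    exact ⟨(h1.2 ⟨hc, by linarith⟩).1, by linarith⟩

/-- The leading term of the Laplace integrals over the part of `D` near the apex of the cone. -/
theorem tendsto_integral_near_apex {p ω ϑ : E3} {δ : ℝ} {Q : Set E3} (hQ : IsConeBase p ω δ Q)
    (hδ : 0 < δ) (k : ℝ) {δ' η : ℝ} (hδ' : 0 < δ') {ρ' : E3 → ℂ}
    (hρ' : ContinuousOn ρ' (closedBall p η)) (hη : 0 < η)
    {N : Set E3} (hN : ∀ x, x ∈ N ↔ x - p ∈ infCone p ω δ Q ∧ -⟪x - p, ω⟫ < δ')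
    (hNη : N ⊆ closedBall p η) {q : ℝ → E3 → ℂ} (hqc : ∀ τ, Continuous (q τ)) {M : ℝ}
    (hqb : ∀ τ, 0 < τ → ∀ x ∈ N, ‖q τ x‖ ≤ M) {q₀ : ℂ}
    (hq : ∀ y, Tendsto (fun τ => q τ (p + τ⁻¹ • y)) atTop (𝓝 q₀)) :
    Tendsto (fun τ : ℝ => (τ : ℂ) ^ 3
        * Complex.exp (-((τ : ℂ) * (⟪p, ω⟫ : ℝ)
          + Complex.I * (√(τ ^ 2 + k ^ 2) : ℝ) * (⟪p, ϑ⟫ : ℝ)))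
        * ∫ x in N, ρ' x * (q τ x * expSol k ω ϑ τ x)) atTop
      (𝓝 (ρ' p * q₀ * ∫ y in infCone p ω δ Q,
        Complex.exp ((⟪y, ω⟫ : ℝ) + Complex.I * (⟪y, ϑ⟫ : ℝ)))) := by
  have hKm := hQ.measurableSet_infCone
  have hNm : MeasurableSet N := by
    have : N = (fun x => x - p) ⁻¹' (infCone p ω δ Q ∩ {y | -⟪y, ω⟫ < δ'}) := Set.ext hN
    rw [this]
    have h0 : MeasurableSet {y : E3 | -⟪y, ω⟫ < δ'} := measurableSet_lt (by fun_prop) (by fun_prop)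
    exact (by fun_prop : Measurable fun x : E3 => x - p) (hKm.inter h0)
  obtain ⟨C, hC⟩ := (isCompact_closedBall p η).exists_bound_of_continuousOn hρ'
  have hC0 : 0 ≤ C := (norm_nonneg _).trans (hC p (mem_closedBall_self hη.le))
  set H : ℝ → Set E3 := fun τ => {y | -⟪y, ω⟫ < τ * δ'} with hH
  have hHm : ∀ τ, MeasurableSet (H τ) := fun τ => measurableSet_lt (by fun_prop) (by fun_prop)
  set g : ℝ → E3 → ℂ := fun τ y => ρ' (p + τ⁻¹ • y) * (q τ (p + τ⁻¹ • y)
    * Complex.exp ((⟪y, ω⟫ : ℝ) + Complex.I * (√(τ ^ 2 + k ^ 2) / τ : ℝ) * (⟪y, ϑ⟫ : ℝ))) with hg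
  -- The blow-up `x = p + y/τ` turns `N` into the cone truncated at depth `τδ'`, and these
  -- truncations exhaust the infinite cone.
  have hmem : ∀ τ, 0 < τ → ∀ y, p + τ⁻¹ • y ∈ N ↔ y ∈ infCone p ω δ Q ∩ H τ := by
    intro τ hτ y
    rw [hN, Set.mem_inter_iff, add_sub_cancel_left, smul_mem_infCone_iff (inv_pos.2 hτ), real_inner_smul_left]
    refine and_congr_right fun _ => ?_
    change _ ↔ -⟪y, ω⟫ < τ * δ'
    rw [← mul_neg, inv_mul_lt_iff₀ hτ]
  have hscale : ∀ τ : ℝ, 0 < τ → (τ : ℂ) ^ 3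
        * Complex.exp (-((τ : ℂ) * (⟪p, ω⟫ : ℝ)
          + Complex.I * (√(τ ^ 2 + k ^ 2) : ℝ) * (⟪p, ϑ⟫ : ℝ)))
        * ∫ x in N, ρ' x * (q τ x * expSol k ω ϑ τ x)
      = ∫ y in infCone p ω δ Q, (H τ).indicator (g τ) y := by
    intro τ hτ
    set E := (τ : ℂ) * (⟪p, ω⟫ : ℝ) + Complex.I * (√(τ ^ 2 + k ^ 2) : ℝ) * (⟪p, ϑ⟫ : ℝ) with hE
    set F := N.indicator fun x => ρ' x * (q τ x * expSol k ω ϑ τ x) with hF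
    have h1 : ∫ x in N, ρ' x * (q τ x * expSol k ω ϑ τ x) = ∫ x, F (p + x) := by
      rw [← integral_indicator hNm, integral_add_left_eq_self F p]
    have h2 := Measure.integral_comp_smul (volume : Measure E3) (fun x => F (p + x)) τ⁻¹
    rw [finrank_euclideanSpace_fin, abs_of_pos (by positivity), Complex.real_smul] at h2
    have h3 : ∀ y, F (p + τ⁻¹ • y)
        = Complex.exp E * (infCone p ω δ Q).indicator ((H τ).indicator (g τ)) y := by
      intro y
      rw [Set.indicator_indicator]
      by_cases hy : p + τ⁻¹ • y ∈ N
      · rw [hF, Set.indicator_of_mem hy, Set.indicator_of_mem ((hmem τ hτ y).1 hy),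
          expSol_add_smul k ω ϑ p y hτ.ne']
        simp only [hg, hE]
        ring
      · rw [hF, Set.indicator_of_notMem hy,
          Set.indicator_of_notMem (fun h => hy ((hmem τ hτ y).2 h)), mul_zero]
    simp_rw [h3] at h2
    rw [integral_const_mul, integral_indicator hKm] at h2
    have h4 : Complex.exp (-E) * Complex.exp E = 1 := by rw [← Complex.exp_add]; simp
    rw [h1]
    have h5 : (((τ⁻¹ ^ 3)⁻¹ : ℝ) : ℂ) = (τ : ℂ) ^ 3 := by push_cast; simp
    rw [h5] at h2
    rw [mul_right_comm, ← h2, mul_comm _ (Complex.exp (-E)), ← mul_assoc, h4, one_mul]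
  rw [← integral_const_mul]
  refine Tendsto.congr' (f₁ := fun τ => ∫ y in infCone p ω δ Q, (H τ).indicator (g τ) y) ?_ ?_
  · filter_upwards [eventually_gt_atTop 0] with τ hτ
    exact (hscale τ hτ).symm
  -- The oscillating factors have modulus one, so the bounds `C` on `ρ'` and `M` on `q` give a
  -- majorant independent of `τ`.
  refine tendsto_integral_filter_of_dominated_convergence
    (fun y => C * M * Real.exp ⟪y, ω⟫) ?_ ?_ ?_ ?_
  · filter_upwards [eventually_gt_atTop 0] with τ hτ
    rw [aestronglyMeasurable_indicator_iff (hHm τ), Measure.restrict_restrict (hHm τ)]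
    refine ContinuousOn.aestronglyMeasurable ?_ ((hHm τ).inter hKm)
    have h1 : ContinuousOn (fun y => ρ' (p + τ⁻¹ • y)) (H τ ∩ infCone p ω δ Q) :=
      hρ'.comp (by fun_prop) fun y hy => hNη ((hmem τ hτ y).2 ⟨hy.2, hy.1⟩)
    have h2 := hqc τ
    exact h1.mul (by fun_prop)
  · filter_upwards [eventually_gt_atTop 0] with τ hτ
    filter_upwards [ae_restrict_mem hKm] with y hy
    by_cases hyH : y ∈ H τ
    · rw [Set.indicator_of_mem hyH]
      have hyN := (hmem τ hτ y).2 ⟨hy, hyH⟩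
      have h1 := hC _ (hNη hyN)
      have h2 := hqb τ hτ _ hyN
      have h3 : ‖Complex.exp ((⟪y, ω⟫ : ℝ)
          + Complex.I * (√(τ ^ 2 + k ^ 2) / τ : ℝ) * (⟪y, ϑ⟫ : ℝ))‖ = Real.exp ⟪y, ω⟫ := by
        rw [Complex.norm_exp, Complex.add_re, Complex.ofReal_re, mul_assoc, ← Complex.ofReal_mul,
          Complex.re_mul_ofReal, Complex.I_re, zero_mul, add_zero]
      simp only [hg]
      rw [norm_mul, norm_mul, h3, mul_assoc]
      gcongr
    · rw [Set.indicator_of_notMem hyH, norm_zero]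
      -- A negative `M` is impossible: rescaled to depth `δ'/2`, the point `y` gives a point of `N`,
      -- where the norm of `q` is at most `M`.
      by_cases hM : 0 ≤ M
      · positivity
      · exfalso
        have hpos : 0 < -⟪y, ω⟫ := neg_pos.2 hy.1
        have hyN : p + ((2 * -⟪y, ω⟫ / δ')⁻¹) • y ∈ N := by
          refine (hmem (2 * -⟪y, ω⟫ / δ') (by positivity) y).2 ⟨hy, ?_⟩
          simp only [hH, Set.mem_ofPred_eq]
          rw [div_mul_cancel₀ _ hδ'.ne']
          linarith
        exact hM ((norm_nonneg _).trans (hqb 1 one_pos _ hyN))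
  · exact (hQ.integrable_infCone hδ).const_mul _
  · filter_upwards [ae_restrict_mem hKm] with y hy
    have hev : ∀ᶠ τ in atTop, y ∈ H τ := by
      have h1 : Tendsto (fun τ : ℝ => τ * δ') atTop atTop := tendsto_id.atTop_mul_const hδ'
      exact h1.eventually_gt_atTop _
    have hlim := tendsto_add_inv_smul p y
    have h1 : Tendsto (fun τ : ℝ => ρ' (p + τ⁻¹ • y)) atTop (𝓝 (ρ' p)) :=
      (hρ'.continuousAt (closedBall_mem_nhds p hη)).tendsto.comp hlim
    have h2 : Tendsto (fun τ : ℝ => ((√(τ ^ 2 + k ^ 2) / τ : ℝ) : ℂ)) atTop (𝓝 1) :=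
      (Complex.continuous_ofReal.tendsto' 1 1 Complex.ofReal_one).comp (tendsto_sqrt_div k)
    have h3 := (((h2.const_mul Complex.I).mul_const ((⟪y, ϑ⟫ : ℝ) : ℂ)).const_add
      ((⟪y, ω⟫ : ℝ) : ℂ)).cexp
    have h4 := h1.mul ((hq y).mul h3)
    rw [mul_one, ← mul_assoc] at h4
    refine h4.congr' ?_
    filter_upwards [hev] with τ hτ
    rw [Set.indicator_of_mem hτ]

/-- The Laplace integrals over the part of `D` away from the apex are exponentially small. -/
theorem tendsto_integral_away {D : Set E3} {ρ : E3 → ℂ} (hρ : IntegrableOn ρ D) (k : ℝ)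
    {p ω ϑ : E3} {δ' : ℝ} (hδ' : 0 < δ') {A : Set E3} (hA : MeasurableSet A) (hAD : A ⊆ D)
    (hAh : ∀ x ∈ A, ⟪x, ω⟫ ≤ ⟪p, ω⟫ - δ') {q : ℝ → E3 → ℂ} {M : ℝ} (hM : 0 ≤ M)
    (hqb : ∀ τ, 0 < τ → ∀ x ∈ D, ‖q τ x‖ ≤ M) :
    Tendsto (fun τ : ℝ => (τ : ℂ) ^ 3
        * Complex.exp (-((τ : ℂ) * (⟪p, ω⟫ : ℝ)
          + Complex.I * (√(τ ^ 2 + k ^ 2) : ℝ) * (⟪p, ϑ⟫ : ℝ)))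
        * ∫ x in A, ρ x * (q τ x * expSol k ω ϑ τ x)) atTop (𝓝 0) := by
  -- On `A` the exponential loses a factor `exp (-τδ')` against its size at `p`, which beats `τ³`.
  have hb := (tendsto_pow_mul_exp_neg_mul hδ' 3).const_mul (M * ∫ x in A, ‖ρ x‖)
  rw [mul_zero] at hb
  refine squeeze_zero_norm' ?_ hb
  filter_upwards [eventually_gt_atTop 0] with τ hτ
  have h1 : ‖∫ x in A, ρ x * (q τ x * expSol k ω ϑ τ x)‖
      ≤ ∫ x in A, M * Real.exp (τ * (⟪p, ω⟫ - δ')) * ‖ρ x‖ := by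
    refine norm_integral_le_of_norm_le ((hρ.mono_set hAD).norm.const_mul _) ?_
    filter_upwards [ae_restrict_mem hA] with x hx
    rw [norm_mul, norm_mul, norm_expSol, mul_comm]
    gcongr
    · exact hqb τ hτ x (hAD hx)
    · exact hAh x hx
  rw [integral_const_mul] at h1
  have h2 : ‖Complex.exp (-((τ : ℂ) * (⟪p, ω⟫ : ℝ)
      + Complex.I * (√(τ ^ 2 + k ^ 2) : ℝ) * (⟪p, ϑ⟫ : ℝ)))‖ = Real.exp (-(τ * ⟪p, ω⟫)) := by
    rw [Complex.norm_exp]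
    simp
  rw [norm_mul, norm_mul, h2, norm_pow, Complex.norm_real, Real.norm_eq_abs, abs_of_pos hτ]
  calc _ ≤ τ ^ 3 * Real.exp (-(τ * ⟪p, ω⟫))
        * (M * Real.exp (τ * (⟪p, ω⟫ - δ')) * ∫ x in A, ‖ρ x‖) := by gcongr
    _ = M * (∫ x in A, ‖ρ x‖)
        * (τ ^ 3 * (Real.exp (-(τ * ⟪p, ω⟫)) * Real.exp (τ * (⟪p, ω⟫ - δ')))) := by ring
    _ = _ := by
      rw [← Real.exp_add]
      congr 3
      ring

/-- The weight `q` treats both indicator integrals at once: `q = 1` for `I`, and the linear factor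
of `v_τ` for `I'`. The set `D` splits into its part near the apex and the exponentially negligible
rest. -/
theorem tendsto_integral_mul_expSol {D : Set E3} {ω ϑ p : E3} {δ : ℝ} {Q : Set E3}
    {ρ ρ' : E3 → ℂ} {η : ℝ} (hω : ‖ω‖ = 1)
    (hωϑ : ⟪ω, ϑ⟫ = 0) (hD : IsOpen D) (hDb : Bornology.IsBounded D) (hp : IsRegularAt D ω p)
    (hQ : HasConicalSingularity D ω p δ Q) (hρ : MemLp ρ 2 (volume.restrict D)) (hη : 0 < η)
    (hρ' : ContinuousOn ρ' (closedBall p η))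
    (hρρ' : ∀ᵐ x ∂(volume.restrict (ball p η ∩ D)), ρ x = ρ' x) (k : ℝ)
    {s : ℝ} (hs : 0 < s) (hsδ : s < δ) {q : ℝ → E3 → ℂ} (hqc : ∀ τ, Continuous (q τ)) {M : ℝ}
    (hM : 0 ≤ M) (hqb : ∀ τ, 0 < τ → ∀ x ∈ D, ‖q τ x‖ ≤ M) {q₀ : ℂ}
    (hq : ∀ y, Tendsto (fun τ => q τ (p + τ⁻¹ • y)) atTop (𝓝 q₀)) :
    Tendsto (fun τ : ℝ => (τ : ℂ) ^ 3
        * Complex.exp (-((τ : ℂ) * (⟪p, ω⟫ : ℝ)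
          + Complex.I * (√(τ ^ 2 + k ^ 2) : ℝ) * (⟪p, ϑ⟫ : ℝ)))
        * ∫ x in D, ρ x * (q τ x * expSol k ω ϑ τ x)) atTop
      (𝓝 (ρ' p * q₀ * coneConstant p ω δ Q ϑ s)) := by
  have hfin : IsFiniteMeasure ((volume : Measure E3).restrict D) :=
    ⟨by simpa using hDb.measure_lt_top⟩
  have hρi : IntegrableOn ρ D := hρ.integrable (by norm_num)
  obtain ⟨c, hc, hcn⟩ := hQ.base.exists_mul_norm_le hQ.pos
  -- Depth below `δ` puts the points of `D` in the cone, and depth below `cη` then puts them in the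
  -- ball where `ρ = ρ'`.
  set δ' := min δ (c * η) with hδ'
  have hδ'0 : 0 < δ' := lt_min hQ.pos (by positivity)
  set N : Set E3 := D ∩ {x | ⟪p, ω⟫ - δ' < ⟪x, ω⟫} with hN
  have hNo : IsOpen N := hD.inter (isOpen_lt continuous_const (by fun_prop))
  have hNmem : ∀ x, x ∈ N ↔ x - p ∈ infCone p ω δ Q ∧ -⟪x - p, ω⟫ < δ' := fun x =>
    hQ.mem_iff hω hD hDb hp (min_le_left _ _) x
  have hNη : N ⊆ ball p η := by
    intro x hx
    obtain ⟨h1, h2⟩ := (hNmem x).1 hx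
    rw [mem_ball, dist_eq_norm]
    have h3 := hcn _ h1
    have h4 : δ' ≤ c * η := min_le_right _ _
    exact lt_of_mul_lt_mul_left (by linarith) hc.le
  have hnear := tendsto_integral_near_apex (ϑ := ϑ) hQ.base hQ.pos k hδ'0 hρ' hη hNmem
    (hNη.trans ball_subset_closedBall) hqc (fun τ hτ x hx => hqb τ hτ x hx.1) hq
  have haway := tendsto_integral_away hρi k (ϑ := ϑ) hδ'0 (A := D \ N)
    (hD.measurableSet.diff hNo.measurableSet) Set.sdiff_subset (fun x hx => by
      by_contra h
      exact hx.2 ⟨hx.1, not_le.1 h⟩) hM hqb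
  have h := hnear.add haway
  rw [add_zero, integral_infCone_eq_coneConstant hω hωϑ hQ.pos hQ.base hs hsδ] at h
  refine h.congr' ?_
  filter_upwards [eventually_gt_atTop 0] with τ hτ
  rw [← mul_add]
  congr 1
  have hint : IntegrableOn (fun x => ρ x * (q τ x * expSol k ω ϑ τ x)) D := by
    have hcont : Continuous fun x => q τ x * expSol k ω ϑ τ x :=
      (hqc τ).mul (contDiff_expSol k ω ϑ τ (n := 0)).continuous
    obtain ⟨B, hB⟩ := hDb.isCompact_closure.exists_bound_of_continuousOn hcont.continuousOn
    refine Integrable.mul_bdd (c := B) hρi hcont.aestronglyMeasurable ?_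
    filter_upwards [ae_restrict_mem hD.measurableSet] with x hx using hB x (subset_closure hx)
  have hND : N ⊆ D := Set.inter_subset_left
  have e1 : ∫ x in N, ρ' x * (q τ x * expSol k ω ϑ τ x)
      = ∫ x in N, ρ x * (q τ x * expSol k ω ϑ τ x) := by
    refine integral_congr_ae ?_
    have h5 : N ⊆ ball p η ∩ D := fun x hx => ⟨hNη hx, hx.1⟩
    filter_upwards [ae_restrict_of_ae_restrict_of_subset h5 hρρ'] with x hx
    rw [hx]
  rw [e1]
  have h6 := integral_inter_add_sdiff (s := D) hNo.measurableSet hint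
  rwa [Set.inter_eq_self_of_subset_right hND] at h6

/-! ### Consequences of the asymptotic formula -/

section Consequences

variable {J : ℝ → ℂ} {E : ℝ → ℂ} {L : ℂ} {h : ℝ}

/-- Only the real part of `E` affects sizes; the oscillation in its imaginary part is invisible to
norms. -/
theorem norm_scaled_eq (hE : ∀ τ, (E τ).re = τ * h) {τ : ℝ} (hτ : 0 < τ) :
    ‖(τ : ℂ) ^ 3 * Complex.exp (-E τ) * J τ‖ = τ ^ 3 * Real.exp (-(τ * h)) * ‖J τ‖ := by
  rw [norm_mul, norm_mul, Complex.norm_exp, Complex.neg_re, hE, norm_pow, Complex.norm_real,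
    Real.norm_eq_abs, abs_of_pos hτ]

theorem eventually_norm_pos_of_tendsto (hL : L ≠ 0)
    (hlim : Tendsto (fun τ : ℝ => (τ : ℂ) ^ 3 * Complex.exp (-E τ) * J τ) atTop (𝓝 L)) :
    ∀ᶠ τ in atTop, 0 < ‖J τ‖ := by
  filter_upwards [hlim.eventually_ne hL] with τ hτ
  exact norm_pos_iff.2 (right_ne_zero_of_mul hτ)

/-- Taking logarithms, `log ‖J‖ = log ‖scaled J‖ - 3 log τ + τh`, where the first term stays
bounded. -/
theorem tendsto_log_norm_div (hE : ∀ τ, (E τ).re = τ * h) (hL : L ≠ 0)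
    (hlim : Tendsto (fun τ : ℝ => (τ : ℂ) ^ 3 * Complex.exp (-E τ) * J τ) atTop (𝓝 L)) :
    Tendsto (fun τ : ℝ => Real.log ‖J τ‖ / τ) atTop (𝓝 h) := by
  have h1 : Tendsto (fun τ : ℝ => Real.log ‖(τ : ℂ) ^ 3 * Complex.exp (-E τ) * J τ‖ / τ) atTop
      (𝓝 0) :=
    (hlim.norm.log (norm_ne_zero_iff.2 hL)).div_atTop tendsto_id
  have h2 : Tendsto (fun τ : ℝ => Real.log τ / τ) atTop (𝓝 0) := by
    simpa using Real.isLittleO_log_id_atTop.tendsto_div_nhds_zero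
  have h3 := (h1.add_const h).sub (h2.const_mul 3)
  rw [zero_add, mul_zero, sub_zero] at h3
  refine h3.congr' ?_
  filter_upwards [eventually_gt_atTop 0, eventually_norm_pos_of_tendsto hL hlim] with τ hτ hJ
  rw [norm_scaled_eq hE hτ, Real.log_mul (by positivity) hJ.ne', Real.log_mul (by positivity)
    (by positivity), Real.log_pow, Real.log_exp]
  field_simp
  push_cast
  ring

theorem tendsto_div_of_tendsto_scaled {J' : ℝ → ℂ} {c : ℂ} (hL : L ≠ 0)
    (hlim : Tendsto (fun τ : ℝ => (τ : ℂ) ^ 3 * Complex.exp (-E τ) * J τ) atTop (𝓝 L))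
    (hlim' : Tendsto (fun τ : ℝ => (τ : ℂ) ^ 3 * Complex.exp (-E τ) * J' τ) atTop (𝓝 (c * L))) :
    Tendsto (fun τ => J' τ / J τ) atTop (𝓝 c) := by
  have h1 := hlim'.div hlim hL
  rw [mul_div_cancel_right₀ _ hL] at h1
  refine h1.congr' ?_
  filter_upwards [eventually_gt_atTop 0] with τ hτ
  have hne : (τ : ℂ) ^ 3 * Complex.exp (-E τ) ≠ 0 :=
    mul_ne_zero (pow_ne_zero _ (by exact_mod_cast hτ.ne')) (Complex.exp_ne_zero _)
  exact mul_div_mul_left _ _ hne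

/-- Even at `t = h` the factor `τ⁻³` left over from the scaling forces decay. -/
theorem tendsto_exp_mul_norm_of_le (hE : ∀ τ, (E τ).re = τ * h)
    (hlim : Tendsto (fun τ : ℝ => (τ : ℂ) ^ 3 * Complex.exp (-E τ) * J τ) atTop (𝓝 L)) {t : ℝ}
    (ht : h ≤ t) : Tendsto (fun τ : ℝ => Real.exp (-τ * t) * ‖J τ‖) atTop (𝓝 0) := by
  have h1 : Tendsto (fun τ : ℝ => (τ ^ 3)⁻¹) atTop (𝓝 0) :=
    (tendsto_pow_atTop (by norm_num)).inv_tendsto_atTop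
  have h2 := hlim.norm.mul h1
  rw [mul_zero] at h2
  refine squeeze_zero' (Eventually.of_forall fun τ => by positivity) ?_ h2
  filter_upwards [eventually_gt_atTop 0] with τ hτ
  rw [norm_scaled_eq hE hτ]
  have h3 : Real.exp (-τ * t) ≤ Real.exp (-(τ * h)) := Real.exp_le_exp.2 (by nlinarith)
  calc _ ≤ Real.exp (-(τ * h)) * ‖J τ‖ := by gcongr
    _ = _ := by field_simp

theorem tendsto_exp_mul_norm_atTop (hE : ∀ τ, (E τ).re = τ * h) (hL : L ≠ 0)
    (hlim : Tendsto (fun τ : ℝ => (τ : ℂ) ^ 3 * Complex.exp (-E τ) * J τ) atTop (𝓝 L)) {t : ℝ}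
    (ht : t < h) : Tendsto (fun τ : ℝ => Real.exp (-τ * t) * ‖J τ‖) atTop atTop := by
  -- The function in question is the scaled norm, with positive limit, times this factor.
  have h1 : Tendsto (fun τ : ℝ => (τ ^ 3 * Real.exp (-(τ * (h - t))))⁻¹) atTop atTop := by
    refine Tendsto.inv_tendsto_nhdsGT_zero (tendsto_nhdsWithin_iff.2
      ⟨tendsto_pow_mul_exp_neg_mul (sub_pos.2 ht) 3, ?_⟩)
    filter_upwards [eventually_gt_atTop 0] with τ hτ
    exact mul_pos (by positivity) (Real.exp_pos _)
  have h2 := hlim.norm.pos_mul_atTop (norm_pos_iff.2 hL) h1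
  refine h2.congr' ?_
  filter_upwards [eventually_gt_atTop 0] with τ hτ
  rw [norm_scaled_eq hE hτ]
  have h3 : Real.exp (-(τ * h)) = Real.exp (-(τ * (h - t))) * Real.exp (-τ * t) := by
    rw [← Real.exp_add]; congr 1; ring
  rw [h3]
  field_simp

end Consequences

theorem exists_norm_factor_le (k : ℝ) {ω ϑ : E3} (hω : ‖ω‖ = 1) (hϑ : ‖ϑ‖ = 1) {D : Set E3}
    (hDb : Bornology.IsBounded D) : ∃ M, 0 ≤ M ∧ ∀ τ : ℝ, 0 < τ → ∀ x ∈ D,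
      ‖((⟪x, ω⟫ : ℝ) : ℂ) + Complex.I * (τ / √(τ ^ 2 + k ^ 2) : ℝ) * (⟪x, ϑ⟫ : ℝ)‖ ≤ M := by
  obtain ⟨R, hR⟩ := hDb.exists_norm_le
  refine ⟨|R| + |R|, by positivity, fun τ hτ x hx => ?_⟩
  have hxR : ‖x‖ ≤ |R| := (hR x hx).trans (le_abs_self R)
  have h1 : |⟪x, ω⟫| ≤ |R| := by
    have := abs_real_inner_le_norm x ω
    rw [hω, mul_one] at this
    exact this.trans hxR
  have h2 : |⟪x, ϑ⟫| ≤ |R| := by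
    have := abs_real_inner_le_norm x ϑ
    rw [hϑ, mul_one] at this
    exact this.trans hxR
  have h3 : |τ / √(τ ^ 2 + k ^ 2)| ≤ 1 := by
    rw [abs_of_nonneg (by positivity), div_le_one (by positivity)]
    exact Real.le_sqrt_of_sq_le (by nlinarith [sq_nonneg k])
  refine (norm_add_le _ _).trans (add_le_add ?_ ?_)
  · rwa [Complex.norm_real]
  · rw [norm_mul, norm_mul, Complex.norm_I, one_mul, Complex.norm_real, Complex.norm_real,
      Real.norm_eq_abs, Real.norm_eq_abs]
    calc _ ≤ 1 * |R| := by gcongr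
      _ = |R| := one_mul _

theorem tendsto_factor (k : ℝ) (ω ϑ p y : E3) :
    Tendsto (fun τ : ℝ => ((⟪p + τ⁻¹ • y, ω⟫ : ℝ) : ℂ)
      + Complex.I * (τ / √(τ ^ 2 + k ^ 2) : ℝ) * (⟪p + τ⁻¹ • y, ϑ⟫ : ℝ)) atTop
      (𝓝 ((⟪p, ω⟫ : ℝ) + Complex.I * (⟪p, ϑ⟫ : ℝ))) := by
  have hlim := tendsto_add_inv_smul p y
  have h1 : ∀ w : E3, Tendsto (fun τ : ℝ => ((⟪p + τ⁻¹ • y, w⟫ : ℝ) : ℂ)) atTop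
      (𝓝 ((⟪p, w⟫ : ℝ) : ℂ)) := fun w =>
    ((by fun_prop : Continuous fun x : E3 => ((⟪x, w⟫ : ℝ) : ℂ)).tendsto p).comp hlim
  have h2 : Tendsto (fun τ : ℝ => ((τ / √(τ ^ 2 + k ^ 2) : ℝ) : ℂ)) atTop (𝓝 1) :=
    (Complex.continuous_ofReal.tendsto' 1 1 Complex.ofReal_one).comp (tendsto_div_sqrt k)
  have h3 := (h1 ω).add ((h2.const_mul Complex.I).mul (h1 ϑ))
  rwa [mul_one] at h3

end EnclosureMethod

end

/-! ### The main theorem -/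

open EnclosureMethod
theorem theorem1p2 (Ω : Set E3) (hΩ : IsBoundedC2Domain Ω)
    (k : ℝ) (hk : 0 ≤ k)
    (D : Set E3) (hD_open : IsOpen D) (hD_ne : D.Nonempty) (hDΩ : closure D ⊆ Ω)
    (ρ : E3 → ℂ) (hρ : MemLp ρ 2 (volume.restrict D))
    (u : SobolevH1 Ω) (hu : IsWeakSolution k (source ρ D) u)
    (g : E3 → ℂ) (hg : IsTrace u g)
    (ω : E3) (hω : ‖ω‖ = 1)
    (p : E3) (hp : IsRegularAt D ω p)
    (δ : ℝ) (Q : Set E3) (hQ : HasConicalSingularity D ω p δ Q)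
    (hact : IsActive ρ D p)
    (ϑ : E3) (hϑ : ‖ϑ‖ = 1) (hωϑ : ⟪ω, ϑ⟫ = 0)
    (s : ℝ) (hs : 0 < s) (hsδ : s < δ) (hC : coneConstant p ω δ Q ϑ s ≠ 0) :
    (∃ τ₀ : ℝ, 0 < τ₀ ∧ ∀ τ : ℝ, τ₀ ≤ τ → 0 < ‖indicatorFn k u g ω ϑ τ‖) ∧
    Tendsto (fun τ : ℝ => Real.log ‖indicatorFn k u g ω ϑ τ‖ / τ) atTop (𝓝 (supportFn D ω)) ∧
    Tendsto (fun τ : ℝ => indicatorFnDeriv k u g ω ϑ τ / indicatorFn k u g ω ϑ τ) atTop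
      (𝓝 ((supportFn D ω : ℂ) + Complex.I * (⟪p, ϑ⟫ : ℝ))) ∧
    (∀ t : ℝ, supportFn D ω ≤ t →
      Tendsto (fun τ : ℝ => Real.exp (-τ * t) * ‖indicatorFn k u g ω ϑ τ‖) atTop (𝓝 0)) ∧
    (∀ t : ℝ, t < supportFn D ω →
      Tendsto (fun τ : ℝ => Real.exp (-τ * t) * ‖indicatorFn k u g ω ϑ τ‖) atTop atTop) := by
  have hDΩ' : D ⊆ Ω := subset_closure.trans hDΩ
  have hDb : Bornology.IsBounded D := hΩ.isBounded.subset hDΩ'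
  obtain ⟨η, hη, α, hα, -, ρ', ⟨K, hK⟩, hρρ', hρ'p⟩ := hact
  have hρ' : ContinuousOn ρ' (closedBall p η) := hK.continuousOn hα
  -- The exponent of `v` at the apex, with real part `τ h_D(ω)`.
  set E : ℝ → ℂ := fun τ => (τ : ℂ) * (⟪p, ω⟫ : ℝ)
    + Complex.I * (√(τ ^ 2 + k ^ 2) : ℝ) * (⟪p, ϑ⟫ : ℝ) with hE
  have hEre : ∀ τ, (E τ).re = τ * supportFn D ω := by
    intro τ
    simp [hE, hp.supportFn_eq]
  have hI : ∀ τ, indicatorFn k u g ω ϑ τ = ∫ x in D, ρ x * (1 * expSol k ω ϑ τ x) := by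
    intro τ
    simp only [one_mul]
    exact boundaryForm_eq_integral hΩ hD_open hDΩ' hρ hu hg (contDiff_expSol k ω ϑ τ)
      (laplace_expSol k hω hϑ hωϑ τ)
  have hI' : ∀ τ, 0 < τ → indicatorFnDeriv k u g ω ϑ τ = ∫ x in D, ρ x *
      ((((⟪x, ω⟫ : ℝ) : ℂ) + Complex.I * (τ / √(τ ^ 2 + k ^ 2) : ℝ) * (⟪x, ϑ⟫ : ℝ))
        * expSol k ω ϑ τ x) := fun τ hτ =>
    boundaryForm_eq_integral hΩ hD_open hDΩ' hρ hu hg (contDiff_expSolDeriv k ω ϑ τ)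
      (laplace_expSolDeriv k hω hϑ hωϑ hτ)
  have hlim : Tendsto (fun τ : ℝ => (τ : ℂ) ^ 3 * Complex.exp (-E τ) * indicatorFn k u g ω ϑ τ)
      atTop (𝓝 (ρ' p * coneConstant p ω δ Q ϑ s)) := by
    have h := tendsto_integral_mul_expSol hω hωϑ hD_open hDb hp hQ hρ hη hρ' hρρ' k hs hsδ
      (q := fun _ _ => 1) (fun _ => continuous_const) zero_le_one (fun _ _ _ _ => by simp)
      (fun _ => tendsto_const_nhds)
    rw [mul_one] at h
    exact h.congr fun τ => by rw [hI]
  obtain ⟨M, hM, hMb⟩ := exists_norm_factor_le k hω hϑ hDb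
  have hlim' : Tendsto (fun τ : ℝ => (τ : ℂ) ^ 3 * Complex.exp (-E τ)
      * indicatorFnDeriv k u g ω ϑ τ) atTop
      (𝓝 (((supportFn D ω : ℂ) + Complex.I * (⟪p, ϑ⟫ : ℝ))
        * (ρ' p * coneConstant p ω δ Q ϑ s))) := by
    have h := tendsto_integral_mul_expSol hω hωϑ hD_open hDb hp hQ hρ hη hρ' hρρ' k hs hsδ
      (q := fun τ x => ((⟪x, ω⟫ : ℝ) : ℂ)
        + Complex.I * (τ / √(τ ^ 2 + k ^ 2) : ℝ) * (⟪x, ϑ⟫ : ℝ))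
      (fun τ => by fun_prop) hM hMb (tendsto_factor k ω ϑ p)
    rw [← hp.supportFn_eq, mul_comm (ρ' p), mul_assoc] at h
    refine h.congr' ?_
    filter_upwards [eventually_gt_atTop 0] with τ hτ
    rw [hI' τ hτ]
    simp only [hE, hp.supportFn_eq]
  have hL : ρ' p * coneConstant p ω δ Q ϑ s ≠ 0 := mul_ne_zero hρ'p hC
  refine ⟨?_, tendsto_log_norm_div hEre hL hlim, tendsto_div_of_tendsto_scaled hL hlim hlim',
    fun t ht => tendsto_exp_mul_norm_of_le hEre hlim ht,
    fun t ht => tendsto_exp_mul_norm_atTop hEre hL hlim ht⟩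
  obtain ⟨τ₁, hτ₁⟩ := eventually_atTop.1 (eventually_norm_pos_of_tendsto hL hlim)
  -- The maximum with `1` only ensures `τ₀ > 0`.
  exact ⟨max τ₁ 1, by positivity, fun τ hτ => hτ₁ τ ((le_max_left _ _).trans hτ)⟩
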